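/- Let $Z$ be a finite-dimensional real normed space with closed unit ball $Z_1$ and dual $Z^*$. Call $f,g\in Z$ orthogonal, $f\diamond g$, if $\|f+g\|=\|f-g\|=\|f\|+\|g\|$, and for $S\subseteq Z$ let $S^\diamond$ be the set of all elements orthogonal to every element of $S$. For $u\in Z^*$ put $F_u=\{f\in Z_1: u(f)=1\}$; the non-empty sets $F_u$ with $\|u\|=1$ are the norm exposed faces of $Z_1$. A norm exposed face $F_u$ is symmetric if there is a linear isometry $S_u$ of $Z$ onto $Z$ with $S_u^2=I$ whose fixed point set is the direct sum of subspaces $(\overline{\mathrm{sp}}\,F_u)\oplus F_u^\diamond$; then $P_1(u)=(I-S_u)/2$, and $P_2(u)$, $P_0(u)$ are the projections onto $\overline{\mathrm{sp}}\,F_u$ and $F_u^\diamond$ with $P_2(u)+P_1(u)+P_0(u)=I$. A geometric tripotent is a $u\in Z^*$ with $\|u\|=1$ that vanishes on $F_u^\diamond$, for which $F_u$ is symmetric and $S_u^*u=u$. Geometric tripotents $u,v$ are orthogonal if $P_0(v)^*u=u$. Suppose that - $Z$ is strongly facially symmetric: every norm exposed face $F_u$ is symmetric, and $S_u^*y=y$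 for every norm exposed face $F_u$ and every $y\in Z^*$ with $\|y\|=1$ and $F_u\subseteq F_y$; - $Z$ is neutral: for every symmetric face $F_u$ and $f\in Z$, $\|P_2(u)f\|=\|f\|$ implies $P_2(u)f=f$; - $Z$ has the joint Peirce decomposition property JP: $S_uS_v=S_{u+v}$ for all orthogonal geometric tripotents $u,v$. Then $Z$ has a finite rank $k$, i.e. every family of pairwise orthogonal geometric tripotents has at most $k$ elements and some such family has exactly $k$ elements, and there are non-zero real Hilbert spaces $H_1,\dots,H_k$ such that $Z$ is isometrically isomorphic to their $\ell_1$-direct sum: $$Z\cong H_1\oplus\cdots\oplus H_k,\qquad \|(h_1,\dots,h_k)\|=\sum_{i=1}^k\|h_i\|.$$ (If $Z=0$, then $k=0$.) -/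

import Mathlib

universe u

namespace FaciallySymmetric

section

variable {Z : Type*} [NormedAddCommGroup Z] [NormedSpace ℝ Z]

/-- Orthogonality `f ⋄ g` of vectors: `‖f + g‖ = ‖f - g‖ = ‖f‖ + ‖g‖`. -/
def Orth (f g : Z) : Prop :=
  ‖f + g‖ = ‖f‖ + ‖g‖ ∧ ‖f - g‖ = ‖f‖ + ‖g‖

/-- `S^⋄`: the set of all vectors orthogonal to each element of `S`. -/
def orthSet (S : Set Z) : Set Z := {g | ∀ f ∈ S, Orth f g}

/-- `F_u = {f : ‖f‖ ≤ 1, u f = 1}`. -/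
def face (u : StrongDual ℝ Z) : Set Z := {f | ‖f‖ ≤ 1 ∧ u f = 1}

/-- Norm exposed faces of the unit ball: the non-empty sets `F_u` with `‖u‖ = 1`. -/
def IsNormExposedFace (F : Set Z) : Prop :=
  F.Nonempty ∧ ∃ u : StrongDual ℝ Z, ‖u‖ = 1 ∧ F = face u

/-- The closed linear span of `F`. -/
def closedSpan (F : Set Z) : Submodule ℝ Z := (Submodule.span ℝ F).topologicalClosure

/-- `S` is a symmetry associated with `F`: a linear isometry of `Z` onto `Z` with `S² = I` whose
fixed point set is the (internal) direct sum of the closed span of `F` and the subspace `F^⋄`. -/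
structure IsSymmetryOf (F : Set Z) (S : Z ≃ₗᵢ[ℝ] Z) : Prop where
  involutive : ∀ f, S (S f) = f
  fixed_eq : ∃ W : Submodule ℝ Z, (W : Set Z) = orthSet F ∧
    Disjoint (closedSpan F) W ∧ {f : Z | S f = f} = (closedSpan F ⊔ W : Submodule ℝ Z)

/-- A symmetric face: a norm exposed face that has an associated symmetry. -/
def IsSymmetricFace (F : Set Z) : Prop :=
  IsNormExposedFace F ∧ ∃ S : Z ≃ₗᵢ[ℝ] Z, IsSymmetryOf F S

/-- `P₂, P₁, P₀` are the geometric Peirce projections of the symmetric face `F`: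
`P₁ = (I - S) / 2` for the symmetry `S` of `F`, while `P₂` and `P₀` are the projections onto the
closed span of `F` and onto `F^⋄` in the decomposition of `Z` given by `P₂ + P₁ + P₀ = I`. -/
structure IsPeirce (F : Set Z) (P₂ P₁ P₀ : Z →ₗ[ℝ] Z) : Prop where
  symmetry : ∃ S : Z ≃ₗᵢ[ℝ] Z, IsSymmetryOf F S ∧ ∀ f, P₁ f = (1 / 2 : ℝ) • (f - S f)
  two_mem : ∀ f, P₂ f ∈ closedSpan F
  zero_mem : ∀ f, P₀ f ∈ orthSet F
  sum_eq : ∀ f, P₂ f + P₁ f + P₀ f = f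

/-- A projective unit: `‖u‖ = 1` and `u` vanishes on `F_u^⋄`. -/
def IsProjectiveUnit (u : StrongDual ℝ Z) : Prop :=
  ‖u‖ = 1 ∧ ∀ f ∈ orthSet (face u), u f = 0

/-- A geometric tripotent: a projective unit `u` such that `F_u` is a symmetric face and
`S_u^* u = u` for a symmetry `S_u` corresponding to `F_u`. -/
structure IsGeometricTripotent (u : StrongDual ℝ Z) : Prop where
  projectiveUnit : IsProjectiveUnit u
  symmetricFace : IsSymmetricFace (face u)
  fixed : ∃ S : Z ≃ₗᵢ[ℝ] Z, IsSymmetryOf (face u) S ∧ ∀ f, u (S f) = u f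

/-- Orthogonality of geometric tripotents: `u ∈ U₀(v)`, i.e. `P₀(v)^* u = u`. -/
def TripotentOrth (u v : StrongDual ℝ Z) : Prop :=
  ∃ P₂ P₁ P₀ : Z →ₗ[ℝ] Z, IsPeirce (face v) P₂ P₁ P₀ ∧ ∀ f, u (P₀ f) = u f

/-- An orthogonal family (set) of geometric tripotents. -/
def IsOrthogonalFamily (T : Set (StrongDual ℝ Z)) : Prop :=
  (∀ u ∈ T, IsGeometricTripotent u) ∧ T.Pairwise TripotentOrth

end

section

variable (Z : Type*) [NormedAddCommGroup Z] [NormedSpace ℝ Z]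

/-- Weakly facially symmetric: every norm exposed face of the unit ball is symmetric. -/
def IsWFS : Prop := ∀ F : Set Z, IsNormExposedFace F → IsSymmetricFace F

/-- Strongly facially symmetric: weakly facially symmetric, and `S_u^* y = y` whenever `F_u` is a
norm exposed face, `‖y‖ = 1` and `F_u ⊆ F_y`. -/
def IsSFS : Prop :=
  IsWFS Z ∧ ∀ F : Set Z, IsNormExposedFace F → ∀ y : StrongDual ℝ Z, ‖y‖ = 1 → F ⊆ face y →
    ∀ S : Z ≃ₗᵢ[ℝ] Z, IsSymmetryOf F S → ∀ f, y (S f) = y f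

/-- Neutral: for every symmetric face, `‖P₂ f‖ = ‖f‖` implies `P₂ f = f`. -/
def IsNeutral : Prop :=
  ∀ F : Set Z, IsSymmetricFace F → ∀ P₂ P₁ P₀ : Z →ₗ[ℝ] Z, IsPeirce F P₂ P₁ P₀ →
    ∀ f, ‖P₂ f‖ = ‖f‖ → P₂ f = f

/-- Joint Peirce decomposition: `S_u S_v = S_{u+v}` for orthogonal geometric tripotents. -/
def HasJP : Prop :=
  ∀ u v : StrongDual ℝ Z, IsGeometricTripotent u → IsGeometricTripotent v → TripotentOrth u v →
    ∀ Su Sv Suv : Z ≃ₗᵢ[ℝ] Z, IsSymmetryOf (face u) Su → IsSymmetryOf (face v) Sv →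
      IsSymmetryOf (face (u + v)) Suv → ∀ f, Su (Sv f) = Suv f

/-- `rank Z = n`: orthogonal families of geometric tripotents have at most `n` elements, and some
orthogonal family has exactly `n` elements. -/
def HasRank (n : ℕ) : Prop :=
  (∀ T : Set (StrongDual ℝ Z), IsOrthogonalFamily T → T.encard ≤ n) ∧
    ∃ T : Set (StrongDual ℝ Z), IsOrthogonalFamily T ∧ T.encard = n

end

end FaciallySymmetric

set_option linter.unusedSectionVars false

namespace FaciallySymmetric

open MeasureTheory in
theorem measurePreserving_of_linearIsometryEquiv {E : Type*} [NormedAddCommGroup E]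
    [NormedSpace ℝ E] [FiniteDimensional ℝ E] [MeasurableSpace E] [BorelSpace E]
    (μ : Measure E) [μ.IsAddHaarMeasure] (T : E ≃ₗᵢ[ℝ] E) : MeasurePreserving T μ μ := by
  refine ⟨T.continuous.measurable, ?_⟩
  have hdet : LinearMap.det (T.toLinearEquiv : E →ₗ[ℝ] E) ≠ 0 :=
    (LinearEquiv.isUnit_det' T.toLinearEquiv).ne_zero
  have h := Measure.map_linearMap_addHaar_eq_smul_addHaar μ hdet
  set c := ENNReal.ofReal |(LinearMap.det (T.toLinearEquiv : E →ₗ[ℝ] E))⁻¹| with hc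
  have h' : Measure.map T μ = c • μ := h
  have hb : Measure.map T μ (Metric.closedBall 0 1) = μ (Metric.closedBall 0 1) := by
    rw [Measure.map_apply T.continuous.measurable measurableSet_closedBall,
      T.preimage_closedBall, map_zero]
  rw [h', Measure.smul_apply, smul_eq_mul] at hb
  have hpos : μ (Metric.closedBall 0 1) ≠ 0 :=
    (Metric.measure_closedBall_pos μ 0 one_pos).ne'
  have htop : μ (Metric.closedBall 0 1) ≠ ⊤ := measure_closedBall_lt_top.ne
  have hc1 : c = 1 := by
    rwa [ENNReal.mul_eq_right hpos htop] at hb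
  rw [h', hc1, one_smul]

/-- Precomposition with a linear isometry, as an isometry of the dual space. -/
noncomputable def dualIsometry {E : Type*} [NormedAddCommGroup E] [NormedSpace ℝ E]
    (S : E ≃ₗᵢ[ℝ] E) : StrongDual ℝ E ≃ₗᵢ[ℝ] StrongDual ℝ E where
  toFun φ := φ.comp (S.toContinuousLinearEquiv : E →L[ℝ] E)
  invFun φ := φ.comp (S.symm.toContinuousLinearEquiv : E →L[ℝ] E)
  map_add' φ ψ := by ext; simp
  map_smul' c φ := by ext; simp
  left_inv φ := by ext; simp
  right_inv φ := by ext; simp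
  norm_map' φ := ContinuousLinearMap.opNorm_comp_linearIsometryEquiv φ S

@[simp]
theorem dualIsometry_apply {E : Type*} [NormedAddCommGroup E] [NormedSpace ℝ E]
    (S : E ≃ₗᵢ[ℝ] E) (φ : StrongDual ℝ E) (f : E) : dualIsometry S φ f = φ (S f) := rfl

open MeasureTheory in
theorem exists_invariant_form (E : Type*) [NormedAddCommGroup E] [NormedSpace ℝ E]
    [FiniteDimensional ℝ E] : ∃ B : E →ₗ[ℝ] E →ₗ[ℝ] ℝ, (∀ x y, B x y = B y x) ∧
      (∀ x, x ≠ 0 → 0 < B x x) ∧ ∀ (S : E ≃ₗᵢ[ℝ] E) (x y), B (S x) (S y) = B x y := by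
  let _ : MeasurableSpace (StrongDual ℝ E) := borel _
  have : BorelSpace (StrongDual ℝ E) := ⟨rfl⟩
  let K : Set (StrongDual ℝ E) := Metric.closedBall 0 1
  have hK : IsCompact K := isCompact_closedBall 0 1
  let μ : Measure (StrongDual ℝ E) := Measure.addHaar
  have hcont : ∀ x : E, Continuous fun φ : StrongDual ℝ E => φ x := fun x => by fun_prop
  have hint : ∀ x y : E, IntegrableOn (fun φ : StrongDual ℝ E => φ x * φ y) K μ := fun x y =>
    ((hcont x).mul (hcont y)).continuousOn.integrableOn_compact hK
  let B : E →ₗ[ℝ] E →ₗ[ℝ] ℝ := LinearMap.mk₂ ℝ (fun x y => ∫ φ in K, φ x * φ y ∂μ)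
    (fun x x' y => by
      rw [← integral_add (hint x y) (hint x' y)]; congr 1; ext φ; simp; ring)
    (fun c x y => by
      rw [smul_eq_mul, ← integral_const_mul]; congr 1; ext φ; simp; ring)
    (fun x y y' => by
      rw [← integral_add (hint x y) (hint x y')]; congr 1; ext φ; simp; ring)
    (fun c x y => by
      rw [smul_eq_mul, ← integral_const_mul]; congr 1; ext φ; simp; ring)
  refine ⟨B, fun x y => ?_, fun x hx => ?_, fun S x y => ?_⟩
  · change ∫ φ in K, φ x * φ y ∂μ = ∫ φ in K, φ y * φ x ∂μ
    simp only [mul_comm]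
  · change 0 < ∫ φ in K, φ x * φ x ∂μ
    rw [setIntegral_pos_iff_support_of_nonneg_ae
      (Filter.Eventually.of_forall fun φ => mul_self_nonneg _) (hint x x)]
    have hU : IsOpen ({φ : StrongDual ℝ E | φ x ≠ 0} ∩ Metric.ball 0 1) :=
      (isOpen_ne_fun (hcont x) continuous_const).inter Metric.isOpen_ball
    obtain ⟨g, hg1, hgx⟩ := exists_dual_vector ℝ x (norm_ne_zero_iff.2 hx)
    have hne : ({φ : StrongDual ℝ E | φ x ≠ 0} ∩ Metric.ball 0 1).Nonempty := by
      refine ⟨(1 / 2 : ℝ) • g, ?_, ?_⟩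
      · have : ‖x‖ ≠ 0 := norm_ne_zero_iff.2 hx
        simp [hgx, this]
      · rw [mem_ball_zero_iff, norm_smul, hg1]; norm_num
    refine (hU.measure_pos μ hne).trans_le (measure_mono ?_)
    rintro φ ⟨h1, h2⟩
    exact ⟨by simpa using h1, Metric.ball_subset_closedBall h2⟩
  · change ∫ φ in K, φ (S x) * φ (S y) ∂μ = ∫ φ in K, φ x * φ y ∂μ
    have hmp := measurePreserving_of_linearIsometryEquiv μ (dualIsometry S)
    have := hmp.setIntegral_preimage_emb
      (dualIsometry S).toHomeomorph.measurableEmbedding (fun φ => φ x * φ y) K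
    rw [(dualIsometry S).preimage_closedBall, map_zero] at this
    exact this

open MeasureTheory in
theorem exists_le_of_countable_cover {E : Type*} [NormedAddCommGroup E] [NormedSpace ℝ E]
    [FiniteDimensional ℝ E] (D : Submodule ℝ E) {C : Set (Submodule ℝ E)} (hC : C.Countable)
    (h : ∀ x ∈ D, ∃ W ∈ C, x ∈ W) : ∃ W ∈ C, D ≤ W := by
  by_contra! hcon
  let _ : MeasurableSpace D := borel _
  have : BorelSpace D := ⟨rfl⟩
  let μ : Measure D := Measure.addHaar
  have hz : μ (⋃ W ∈ C, ((W.comap D.subtype : Submodule ℝ D) : Set D)) = 0 := by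
    rw [measure_biUnion_null_iff hC]
    intro W hW
    refine Measure.addHaar_submodule μ _ fun ht => hcon W hW ?_
    rwa [Submodule.comap_subtype_eq_top] at ht
  have hu : (⋃ W ∈ C, ((W.comap D.subtype : Submodule ℝ D) : Set D)) = Set.univ := by
    ext x
    obtain ⟨W, hW, hx⟩ := h x x.2
    simp only [Set.mem_iUnion, Set.mem_univ, iff_true]
    exact ⟨W, hW, hx⟩
  rw [hu] at hz
  exact (isOpen_univ.measure_pos μ ⟨0, trivial⟩).ne' hz

theorem exists_maximal_card {α : Type*} {P : Finset α → Prop} {N : ℕ} (h : ∃ T, P T)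
    (hN : ∀ T, P T → T.card ≤ N) : ∃ T, P T ∧ ∀ T', P T' → T'.card ≤ T.card := by
  have hfin : (Finset.card '' {T | P T}).Finite :=
    (Set.finite_Iic N).subset (by rintro _ ⟨T, hT, rfl⟩; exact hN T hT)
  obtain ⟨T, hT, hmax⟩ := Set.exists_max_image (Finset.card '' {T | P T}) id hfin
    (h.elim fun T hT => ⟨_, T, hT, rfl⟩)
  obtain ⟨T, hT, rfl⟩ := hT
  exact ⟨T, hT, fun T' hT' => hmax _ ⟨T', hT', rfl⟩⟩

/-- Two involutive linear isometries with the same fixed points are equal. -/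
theorem involution_unique {Z : Type*} [NormedAddCommGroup Z] [NormedSpace ℝ Z]
    {S S' : Z ≃ₗᵢ[ℝ] Z} (hS : ∀ f, S (S f) = f) (hS' : ∀ f, S' (S' f) = f)
    (h : ∀ f, S f = f ↔ S' f = f) (f : Z) : S f = S' f := by
  set d := S f - S' f with hd
  have h1 : S (f + S f) = f + S f := by rw [map_add, hS, add_comm]
  have h2 : S (f + S' f) = f + S' f := (h _).2 (by rw [map_add, hS', add_comm])
  have hdS : S d = d := by
    have : d = (f + S f) - (f + S' f) := by rw [hd]; abel
    rw [this, map_sub, h1, h2]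
  have hdS' : S' d = d := (h _).1 hdS
  have hT : ∀ n : ℕ, ‖f - (n : ℝ) • d‖ = ‖f‖ := by
    intro n
    induction n with
    | zero => simp
    | succ n ih =>
      rw [← ih, ← (S'.trans S).norm_map (f - (n : ℝ) • d)]
      congr 1
      have h3 : S (S' f) = f - d := by
        have : S (S' f) = S (f + S' f) - S f := by rw [map_add]; abel
        rw [this, h2, hd]; abel
      simp only [LinearIsometryEquiv.trans_apply, map_sub, map_smul, h3, hdS, hdS']
      push_cast
      module
  have hd0 : ‖d‖ = 0 := by
    by_contra hne
    have hpos : 0 < ‖d‖ := lt_of_le_of_ne (norm_nonneg _) (Ne.symm hne)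
    obtain ⟨n, hn⟩ := exists_nat_gt (2 * ‖f‖ / ‖d‖)
    rw [div_lt_iff₀ hpos] at hn
    have h4 : ‖(n : ℝ) • d‖ ≤ ‖f‖ + ‖f - (n : ℝ) • d‖ := by
      have : (n : ℝ) • d = f - (f - (n : ℝ) • d) := by abel
      rw [this]
      refine (norm_sub_le _ _).trans ?_
      simp
    rw [hT, norm_smul, Real.norm_natCast] at h4
    linarith
  rw [norm_eq_zero, hd, sub_eq_zero] at hd0
  exact hd0

section

variable {Z : Type*} [NormedAddCommGroup Z] [NormedSpace ℝ Z]

theorem Orth.symm {f g : Z} (h : Orth f g) : Orth g f :=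
  ⟨by rw [add_comm, h.1, add_comm], by rw [norm_sub_rev, h.2, add_comm]⟩

theorem Orth.neg_right {f g : Z} (h : Orth f g) : Orth f (-g) :=
  ⟨by rw [← sub_eq_add_neg, h.2, norm_neg], by rw [sub_neg_eq_add, h.1, norm_neg]⟩

theorem Orth.neg_left {f g : Z} (h : Orth f g) : Orth (-f) g := h.symm.neg_right.symm

theorem Orth.smul {f g : Z} (h : Orth f g) (c : ℝ) : Orth (c • f) (c • g) := by
  constructor
  · rw [← smul_add, norm_smul, h.1, norm_smul, norm_smul, mul_add]
  · rw [← smul_sub, norm_smul, h.2, norm_smul, norm_smul, mul_add]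

theorem Orth.map {f g : Z} (h : Orth f g) (S : Z ≃ₗᵢ[ℝ] Z) : Orth (S f) (S g) := by
  constructor
  · rw [← map_add, S.norm_map, h.1, S.norm_map, S.norm_map]
  · rw [← map_sub, S.norm_map, h.2, S.norm_map, S.norm_map]

theorem orth_zero_right (f : Z) : Orth f 0 := by simp [Orth]

theorem Orth.eq_zero {f : Z} (h : Orth f f) : f = 0 := by
  have := h.2
  rw [sub_self, norm_zero] at this
  exact norm_eq_zero.1 (by linarith [norm_nonneg f])

theorem le_norm_of_norm_le_one {x : StrongDual ℝ Z} (hx : ‖x‖ ≤ 1) (f : Z) : x f ≤ ‖f‖ :=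
  (le_abs_self _).trans ((x.le_opNorm f).trans (mul_le_of_le_one_left (norm_nonneg _) hx))

theorem norm_of_mem_face {x : StrongDual ℝ Z} (hx : ‖x‖ ≤ 1) {f : Z} (hf : f ∈ face x) :
    ‖f‖ = 1 :=
  le_antisymm hf.1 (hf.2 ▸ le_norm_of_norm_le_one hx f)

theorem eqOn_span_face {x y : StrongDual ℝ Z} (h : face x ⊆ face y) {f : Z}
    (hf : f ∈ Submodule.span ℝ (face x)) : x f = y f := by
  have : Set.EqOn (x : Z →ₗ[ℝ] ℝ) (y : Z →ₗ[ℝ] ℝ) (face x) := fun g hg => by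
    simp [hg.2, (h hg).2]
  exact LinearMap.eqOn_span this hf

theorem norm_eq_one_of_apply {x : StrongDual ℝ Z} (hx : ‖x‖ ≤ 1) {f : Z} (hf : ‖f‖ ≤ 1)
    (h : x f = 1) : ‖x‖ = 1 := by
  refine le_antisymm hx ?_
  have := x.le_opNorm f
  rw [h, norm_one] at this
  nlinarith [norm_nonneg x]

theorem face_neg (x : StrongDual ℝ Z) {f : Z} : f ∈ face (-x) ↔ -f ∈ face x := by
  simp [face]

/-- The symmetry associated with the face of `u` (with a junk value when there is none). -/
noncomputable def sym (u : StrongDual ℝ Z) : Z ≃ₗᵢ[ℝ] Z :=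
  open Classical in
  if h : ∃ S : Z ≃ₗᵢ[ℝ] Z, IsSymmetryOf (face u) S then h.choose else .refl ℝ Z

/-- The Peirce space spanned by the face of `u`. -/
def V2 (u : StrongDual ℝ Z) : Submodule ℝ Z := Submodule.span ℝ (face u)

/-- The Peirce space of vectors orthogonal to the face of `u`. -/
def V0 (u : StrongDual ℝ Z) : Submodule ℝ Z := Submodule.span ℝ (orthSet (face u))

theorem face_subset_V2 (u : StrongDual ℝ Z) : face u ⊆ V2 u := Submodule.subset_span

end

section

variable {Z : Type*} [NormedAddCommGroup Z] [NormedSpace ℝ Z] [FiniteDimensional ℝ Z]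
variable {u v w x : StrongDual ℝ Z}

theorem closedSpan_eq (F : Set Z) : closedSpan F = Submodule.span ℝ F :=
  (Submodule.closed_of_finiteDimensional _).submodule_topologicalClosure_eq

theorem face_nonempty (hu : ‖u‖ = 1) : (face u).Nonempty := by
  obtain ⟨f, hf, hmax⟩ := (isCompact_closedBall (0 : Z) 1).exists_isMaxOn
    ⟨0, by simp⟩ u.continuous.continuousOn
  have hf1 : ‖f‖ ≤ 1 := by simpa using hf
  refine ⟨f, hf1, le_antisymm ((le_norm_of_norm_le_one hu.le f).trans hf1) ?_⟩
  rw [← hu]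
  have h0 : 0 ≤ u f := by simpa using hmax (a := 0) (by simp)
  refine u.opNorm_le_of_unit_norm h0 fun g hg => ?_
  rw [Real.norm_eq_abs, abs_le]
  constructor
  · have h2 : u (-g) ≤ u f := hmax (a := -g) (by simp [hg])
    rw [map_neg] at h2
    linarith
  · exact hmax (a := g) (by simp [hg])

theorem isNormExposedFace_face (hu : ‖u‖ = 1) : IsNormExposedFace (face u) :=
  ⟨face_nonempty hu, u, hu, rfl⟩

theorem exists_exposing (hu : ‖u‖ = 1) {g : Z} (hg : ‖g‖ = 1) (h : ∀ f ∈ face u, Orth f g) :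
    ∃ w : StrongDual ℝ Z, ‖w‖ = 1 ∧ g ∈ face w ∧ ∀ k ∈ face w, ∀ f ∈ face u, Orth f k := by
  obtain ⟨b, hbF, hspan, hli⟩ := exists_linearIndependent ℝ (face u)
  have hfin : b.Finite := hli.setFinite
  lift b to Finset Z using hfin
  have hb : b.Nonempty := by
    rw [Finset.nonempty_iff_ne_empty]
    rintro rfl
    obtain ⟨f, hf⟩ := face_nonempty hu
    have : f ∈ Submodule.span ℝ (face u) := Submodule.subset_span hf
    rw [← hspan] at this
    have hf0 : f = 0 := by simpa using this
    have := hf.2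
    simp [hf0] at this
  have hn : (0 : ℝ) < b.card := by exact_mod_cast hb.card_pos
  set c : Z := (b.card : ℝ)⁻¹ • ∑ f ∈ b, f with hc
  have huc : u c = 1 := by
    rw [hc, map_smul, map_sum, Finset.sum_congr rfl fun f hf => (hbF hf).2]
    simp [hn.ne']
  have hnc : ‖c‖ ≤ 1 := by
    rw [hc, norm_smul, norm_inv, Real.norm_natCast, inv_mul_le_iff₀ hn, mul_one]
    refine (norm_sum_le _ _).trans ((Finset.sum_le_sum fun f hf => (hbF hf).1).trans ?_)
    simp
  have hnc1 : ‖c‖ = 1 := norm_of_mem_face hu.le ⟨hnc, huc⟩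
  have ho : Orth c g := h c ⟨hnc, huc⟩
  have key : ∀ g' : Z, ‖g'‖ = 1 → ‖c + g'‖ = 2 → ∃ x : StrongDual ℝ Z, ‖x‖ ≤ 1 ∧ x g' = 1 ∧
      ∀ f ∈ face u, x f = 1 := by
    intro g' hg' hcg
    obtain ⟨x, hx1, hx⟩ := exists_dual_vector'' ℝ (c + g')
    have hx' : x c + x g' = 2 := by rw [← map_add, hx, hcg]; rfl
    have h1 : x c ≤ 1 := (le_norm_of_norm_le_one hx1 c).trans hnc
    have h2 : x g' ≤ 1 := (le_norm_of_norm_le_one hx1 g').trans hg'.le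
    have hxc : x c = 1 := by linarith
    have hsum : ∑ f ∈ b, x f = ∑ f ∈ b, (1 : ℝ) := by
      rw [hc, map_smul, map_sum, smul_eq_mul, inv_mul_eq_one₀ hn.ne'] at hxc
      simp [← hxc]
    have hall := (Finset.sum_eq_sum_iff_of_le fun f hf =>
      (le_norm_of_norm_le_one hx1 f).trans (hbF hf).1).1 hsum
    refine ⟨x, hx1, by linarith, fun f hf => ?_⟩
    have hfs : f ∈ Submodule.span ℝ (b : Set Z) := hspan ▸ Submodule.subset_span hf
    have heq : Set.EqOn (x : Z →ₗ[ℝ] ℝ) (u : Z →ₗ[ℝ] ℝ) b := fun k hk => by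
      simp [hall k hk, (hbF hk).2]
    have := LinearMap.eqOn_span heq hfs
    simpa [hf.2] using this
  obtain ⟨x, hx1, hxg, hxF⟩ := key g hg (by rw [ho.1, hnc1, hg]; norm_num)
  obtain ⟨y, hy1, hyg, hyF⟩ := key (-g) (by simpa using hg)
    (by rw [← sub_eq_add_neg, ho.2, hnc1, hg]; norm_num)
  have hyg' : y g = -1 := by rw [map_neg] at hyg; linarith
  have hw1 : ‖(1 / 2 : ℝ) • (x - y)‖ ≤ 1 := by
    rw [norm_smul]
    have := norm_sub_le x y
    norm_num
    linarith
  have hwg : ((1 / 2 : ℝ) • (x - y)) g = 1 := by simp [hxg, hyg']; norm_num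
  refine ⟨(1 / 2 : ℝ) • (x - y), norm_eq_one_of_apply hw1 hg.le hwg, ⟨hg.le, hwg⟩, ?_⟩
  intro k hk f hf
  have hk2 : x k - y k = 2 := by
    have := hk.2
    simp at this
    linarith
  have hxk : x k ≤ 1 := (le_norm_of_norm_le_one hx1 k).trans hk.1
  have hyk : -y k ≤ 1 := by
    have := (le_norm_of_norm_le_one hy1 (-k)).trans (by simpa using hk.1)
    simpa using this
  have hnf := norm_of_mem_face hu.le hf
  have hnk := norm_of_mem_face hw1 hk
  constructor
  · refine le_antisymm (norm_add_le _ _) ?_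
    have := le_norm_of_norm_le_one hx1 (f + k)
    rw [map_add, hxF f hf] at this
    linarith
  · refine le_antisymm (norm_sub_le _ _) ?_
    have := le_norm_of_norm_le_one hy1 (f - k)
    rw [map_sub, hyF f hf] at this
    linarith

variable [hS : Fact (IsSFS Z)]

theorem isSymmetryOf_sym (hu : ‖u‖ = 1) : IsSymmetryOf (face u) (sym u) := by
  have h := (hS.out.1 _ (isNormExposedFace_face hu)).2
  rw [sym, dif_pos h]
  exact h.choose_spec

theorem sym_sym (hu : ‖u‖ = 1) (f : Z) : sym u (sym u f) = f :=
  (isSymmetryOf_sym hu).involutive f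

theorem mem_V0 (hu : ‖u‖ = 1) {g : Z} : g ∈ V0 u ↔ ∀ f ∈ face u, Orth f g := by
  obtain ⟨W, hW, -⟩ := (isSymmetryOf_sym hu).fixed_eq
  rw [V0, ← hW, Submodule.span_eq, ← SetLike.mem_coe, hW]
  rfl

theorem coe_V0 (hu : ‖u‖ = 1) : (V0 u : Set Z) = orthSet (face u) := by
  ext g
  exact mem_V0 hu

theorem disjoint_V2_V0 (hu : ‖u‖ = 1) : Disjoint (V2 u) (V0 u) := by
  obtain ⟨W, hW, hd, -⟩ := (isSymmetryOf_sym hu).fixed_eq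
  rw [closedSpan_eq] at hd
  have : V0 u = W := SetLike.coe_injective ((coe_V0 hu).trans hW.symm)
  rwa [this]

theorem IsSymmetryOf.apply_eq_iff (hu : ‖u‖ = 1) {S : Z ≃ₗᵢ[ℝ] Z} (h : IsSymmetryOf (face u) S)
    {f : Z} : S f = f ↔ f ∈ V2 u ⊔ V0 u := by
  obtain ⟨W, hW, hd, he⟩ := h.fixed_eq
  rw [closedSpan_eq] at he
  have : V0 u = W := SetLike.coe_injective ((coe_V0 hu).trans hW.symm)
  rw [this, ← SetLike.mem_coe, V2, ← he]
  rfl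

theorem sym_eq_iff (hu : ‖u‖ = 1) {f : Z} : sym u f = f ↔ f ∈ V2 u ⊔ V0 u :=
  (isSymmetryOf_sym hu).apply_eq_iff hu

theorem IsSymmetryOf.eq_sym (hu : ‖u‖ = 1) {S : Z ≃ₗᵢ[ℝ] Z} (h : IsSymmetryOf (face u) S) (f : Z) :
    S f = sym u f :=
  involution_unique h.involutive (sym_sym hu) (fun _ => by rw [h.apply_eq_iff hu, sym_eq_iff hu]) f

theorem sym_of_mem_V2 (hu : ‖u‖ = 1) {f : Z} (hf : f ∈ V2 u) : sym u f = f :=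
  (sym_eq_iff hu).2 (Submodule.mem_sup_left hf)

theorem sym_of_mem_V0 (hu : ‖u‖ = 1) {f : Z} (hf : f ∈ V0 u) : sym u f = f :=
  (sym_eq_iff hu).2 (Submodule.mem_sup_right hf)

theorem peirce_unique (hu : ‖u‖ = 1) {a a' b b' : Z} (ha : a ∈ V2 u) (ha' : a' ∈ V2 u)
    (hb : b ∈ V0 u) (hb' : b' ∈ V0 u) (h : a + b = a' + b') : a = a' ∧ b = b' := by
  have h1 : a - a' = b' - b := by rw [sub_eq_sub_iff_add_eq_add, h, add_comm]
  have h2 : a - a' = 0 := by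
    refine (Submodule.disjoint_def.1 (disjoint_V2_V0 hu)) _ (sub_mem ha ha') ?_
    rw [h1]
    exact sub_mem hb' hb
  refine ⟨sub_eq_zero.1 h2, ?_⟩
  rw [h2] at h1
  exact (sub_eq_zero.1 h1.symm).symm

theorem exists_peirce (u : StrongDual ℝ Z) : ∃ P : (Z →ₗ[ℝ] Z) × (Z →ₗ[ℝ] Z), ‖u‖ = 1 →
    (∀ f, P.1 f ∈ V2 u) ∧ (∀ f, P.2 f ∈ V0 u) ∧
      ∀ f, P.1 f + P.2 f = (1 / 2 : ℝ) • (f + sym u f) := by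
  by_cases hu : ‖u‖ = 1
  swap
  · exact ⟨0, fun h => absurd h hu⟩
  obtain ⟨C, hC, hcompl⟩ := (disjoint_V2_V0 hu).symm.exists_isCompl
  let A : Z →ₗ[ℝ] Z := (1 / 2 : ℝ) • (LinearMap.id + (sym u).toLinearEquiv.toLinearMap)
  have hA : ∀ f, A f = (1 / 2 : ℝ) • (f + sym u f) := fun f => rfl
  let P : Z →ₗ[ℝ] Z := (V2 u).subtype ∘ₗ Submodule.projectionOnto _ _ hcompl.symm ∘ₗ A
  refine ⟨(P, A - P), fun _ => ⟨fun f => ?_, fun f => ?_, fun f => ?_⟩⟩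
  · exact Submodule.coe_mem _
  · have hm : A f ∈ V2 u ⊔ V0 u := by
      rw [← sym_eq_iff hu, hA, map_smul, map_add, sym_sym hu, add_comm]
    obtain ⟨a, ha, b, hb, hab⟩ := Submodule.mem_sup.1 hm
    have hP : P f = a := by
      change ((Submodule.projectionOnto _ _ hcompl.symm (A f) : V2 u) : Z) = a
      rw [← hab, map_add, Submodule.projectionOnto_apply_of_mem_right _ (hC hb),
        Submodule.projectionOnto_apply_left hcompl.symm ⟨a, ha⟩]
      simp
    change A f - P f ∈ V0 u
    rw [hP, ← hab]
    simpa using hb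
  · change P f + (A f - P f) = _
    rw [add_sub_cancel, hA]

/-- The geometric Peirce 2-projection of the face of `u`. -/
noncomputable def P2 (u : StrongDual ℝ Z) : Z →ₗ[ℝ] Z := (exists_peirce u).choose.1

/-- The geometric Peirce 0-projection of the face of `u`. -/
noncomputable def P0 (u : StrongDual ℝ Z) : Z →ₗ[ℝ] Z := (exists_peirce u).choose.2

theorem P2_mem (hu : ‖u‖ = 1) (f : Z) : P2 u f ∈ V2 u := ((exists_peirce u).choose_spec hu).1 f

theorem P0_mem (hu : ‖u‖ = 1) (f : Z) : P0 u f ∈ V0 u := ((exists_peirce u).choose_spec hu).2.1 f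

theorem P2_add_P0 (hu : ‖u‖ = 1) (f : Z) : P2 u f + P0 u f = (1 / 2 : ℝ) • (f + sym u f) :=
  ((exists_peirce u).choose_spec hu).2.2 f

theorem P2_P0_of_add (hu : ‖u‖ = 1) {a b f : Z} (ha : a ∈ V2 u) (hb : b ∈ V0 u)
    (h : a + b = (1 / 2 : ℝ) • (f + sym u f)) : P2 u f = a ∧ P0 u f = b :=
  peirce_unique hu (P2_mem hu f) ha (P0_mem hu f) hb ((P2_add_P0 hu f).trans h.symm)

theorem P2_P0_of_mem_V2 (hu : ‖u‖ = 1) {f : Z} (hf : f ∈ V2 u) : P2 u f = f ∧ P0 u f = 0 :=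
  P2_P0_of_add hu hf (zero_mem _) (by rw [sym_of_mem_V2 hu hf]; module)

theorem P2_P0_of_mem_V0 (hu : ‖u‖ = 1) {f : Z} (hf : f ∈ V0 u) : P2 u f = 0 ∧ P0 u f = f :=
  P2_P0_of_add hu (zero_mem _) hf (by rw [sym_of_mem_V0 hu hf]; module)

theorem peirce_decomp (hu : ‖u‖ = 1) (f : Z) :
    f = P2 u f + P0 u f + (1 / 2 : ℝ) • (f - sym u f) := by
  rw [P2_add_P0 hu]; module

theorem orth_of_mem (hu : ‖u‖ = 1) {f g : Z} (hf : f ∈ V2 u) (hg : g ∈ V0 u) : Orth f g := by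
  rcases eq_or_ne g 0 with rfl | h0
  · exact orth_zero_right f
  have hn : ‖g‖ ≠ 0 := norm_ne_zero_iff.2 h0
  have hg1 : ‖‖g‖⁻¹ • g‖ = 1 := by rw [norm_smul, norm_inv, norm_norm, inv_mul_cancel₀ hn]
  obtain ⟨w, hw, hgw, hF⟩ := exists_exposing hu hg1 ((mem_V0 hu).1 ((V0 u).smul_mem ‖g‖⁻¹ hg))
  have hle : V2 u ≤ V0 w :=
    Submodule.span_le.2 fun k hk => (mem_V0 hw).2 fun l hl => (hF l hl k hk).symm
  have := ((mem_V0 hw).1 ((V0 w).smul_mem ‖g‖⁻¹ (hle hf)) _ hgw).symm.smul ‖g‖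
  rwa [smul_inv_smul₀ hn, smul_inv_smul₀ hn] at this

theorem norm_P2_add_norm_P0_le (hu : ‖u‖ = 1) (f : Z) : ‖P2 u f‖ + ‖P0 u f‖ ≤ ‖f‖ := by
  rw [← (orth_of_mem hu (P2_mem hu f) (P0_mem hu f)).1, P2_add_P0 hu, norm_smul]
  have := norm_add_le f (sym u f)
  rw [(sym u).norm_map] at this
  norm_num
  linarith

theorem norm_P2_le (hu : ‖u‖ = 1) (f : Z) : ‖P2 u f‖ ≤ ‖f‖ := by
  linarith [norm_P2_add_norm_P0_le hu f, norm_nonneg (P0 u f)]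

theorem norm_P0_le (hu : ‖u‖ = 1) (f : Z) : ‖P0 u f‖ ≤ ‖f‖ := by
  linarith [norm_P2_add_norm_P0_le hu f, norm_nonneg (P2 u f)]

theorem isPeirce (hu : ‖u‖ = 1) : IsPeirce (face u) (P2 u)
    ((1 / 2 : ℝ) • (LinearMap.id - (sym u).toLinearEquiv.toLinearMap)) (P0 u) where
  symmetry := ⟨sym u, isSymmetryOf_sym hu, fun f => rfl⟩
  two_mem f := by rw [closedSpan_eq]; exact P2_mem hu f
  zero_mem f := by rw [← coe_V0 hu]; exact P0_mem hu f
  sum_eq f := by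
    conv_rhs => rw [peirce_decomp hu f]
    rw [add_right_comm]
    rfl

/-- A functional composed with a linear endomorphism. -/
noncomputable def pull (P : Z →ₗ[ℝ] Z) (x : StrongDual ℝ Z) : StrongDual ℝ Z :=
  x.comp (LinearMap.toContinuousLinearMap P)

@[simp]
theorem pull_apply (P : Z →ₗ[ℝ] Z) (x : StrongDual ℝ Z) (f : Z) : pull P x f = x (P f) := rfl

theorem norm_pull_le {P : Z →ₗ[ℝ] Z} (hP : ∀ f, ‖P f‖ ≤ ‖f‖) {x : StrongDual ℝ Z} (hx : ‖x‖ ≤ 1) :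
    ‖pull P x‖ ≤ 1 := by
  refine ContinuousLinearMap.opNorm_le_bound _ zero_le_one fun f => ?_
  rw [pull_apply]
  exact (x.le_opNorm _).trans (mul_le_mul hx (hP f) (norm_nonneg _) zero_le_one)

theorem apply_sym_of_face_subset (hu : ‖u‖ = 1) (hx : ‖x‖ = 1) (h : face u ⊆ face x) (f : Z) :
    x (sym u f) = x f :=
  hS.out.2 _ (isNormExposedFace_face hu) x hx h _ (isSymmetryOf_sym hu) f

theorem IsGeometricTripotent.norm_eq (h : IsGeometricTripotent u) : ‖u‖ = 1 := h.projectiveUnit.1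

theorem isGeometricTripotent_iff :
    IsGeometricTripotent u ↔ ‖u‖ = 1 ∧ ∀ f ∈ V0 u, u f = 0 := by
  refine ⟨fun h => ⟨h.norm_eq, fun f hf => h.projectiveUnit.2 f ?_⟩, fun h => ⟨⟨h.1, ?_⟩, ?_, ?_⟩⟩
  · rwa [← coe_V0 h.norm_eq]
  · intro f hf
    rw [← coe_V0 h.1] at hf
    exact h.2 f hf
  · exact hS.out.1 _ (isNormExposedFace_face h.1)
  · exact ⟨sym u, isSymmetryOf_sym h.1, apply_sym_of_face_subset h.1 h.1 subset_rfl⟩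

theorem IsGeometricTripotent.apply_V0 (h : IsGeometricTripotent u) {f : Z} (hf : f ∈ V0 u) :
    u f = 0 := (isGeometricTripotent_iff.1 h).2 f hf

/-- A functional of norm one which restricts to `0` on `V0 u` and whose face contains that of `u`
is determined by its values on `V2 u`. -/
theorem apply_P2_of_face_subset (hu : ‖u‖ = 1) (hx : ‖x‖ = 1) (h : face u ⊆ face x)
    (h0 : ∀ g ∈ V0 u, x g = 0) (f : Z) : x (P2 u f) = x f := by
  conv_rhs => rw [peirce_decomp hu f]
  simp [apply_sym_of_face_subset hu hx h f, h0 _ (P0_mem hu f)]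

theorem IsGeometricTripotent.apply_P2 (h : IsGeometricTripotent u) (f : Z) : u (P2 u f) = u f :=
  apply_P2_of_face_subset h.norm_eq h.norm_eq subset_rfl (fun _ => h.apply_V0) f

theorem IsGeometricTripotent.ext_face (hu : IsGeometricTripotent u) (hv : IsGeometricTripotent v)
    (h : face u = face v) : u = v := by
  ext f
  rw [← hu.apply_P2 f, ← apply_P2_of_face_subset hu.norm_eq hv.norm_eq h.subset
    (fun g hg => hv.apply_V0 (by rwa [V0, ← h])) f]
  exact eqOn_span_face h.subset (P2_mem hu.norm_eq f)

theorem IsGeometricTripotent.dualIsometry (hu : IsGeometricTripotent u) (R : Z ≃ₗᵢ[ℝ] Z) :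
    IsGeometricTripotent (dualIsometry R u) := by
  have hn : ‖FaciallySymmetric.dualIsometry R u‖ = 1 := by
    rw [LinearIsometryEquiv.norm_map, hu.norm_eq]
  refine isGeometricTripotent_iff.2 ⟨hn, fun f hf => ?_⟩
  rw [dualIsometry_apply]
  refine hu.apply_V0 ((mem_V0 hu.norm_eq).2 fun g hg => ?_)
  have := ((mem_V0 hn).1 hf (R.symm g) ⟨by simpa using hg.1, by simpa using hg.2⟩).map R
  simpa using this

theorem mem_face_dualIsometry (R : Z ≃ₗᵢ[ℝ] Z) {f : Z} :
    f ∈ face (dualIsometry R u) ↔ R f ∈ face u := by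
  simp [face]

/-- A geometric tripotent is invariant under isometries fixing its face pointwise. -/
theorem IsGeometricTripotent.apply_of_fixed (hu : IsGeometricTripotent u) {R : Z ≃ₗᵢ[ℝ] Z}
    (hR : ∀ f ∈ face u, R f = f) (f : Z) : u (R f) = u f := by
  have : FaciallySymmetric.dualIsometry R u = u := by
    refine (hu.dualIsometry R).ext_face hu ?_
    ext g
    rw [mem_face_dualIsometry]
    refine ⟨fun hg => ?_, fun hg => by rwa [hR g hg]⟩
    have : R (R g) = R g := hR _ hg
    rwa [R.injective this] at hg
  exact DFunLike.congr_fun this f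

theorem IsGeometricTripotent.neg (hu : IsGeometricTripotent u) : IsGeometricTripotent (-u) := by
  have := hu.dualIsometry (LinearIsometryEquiv.neg ℝ)
  convert this using 1
  ext f
  simp

theorem V2_neg (u : StrongDual ℝ Z) : V2 (-u) = V2 u := by
  have h : ∀ u : StrongDual ℝ Z, V2 (-u) ≤ V2 u := fun u =>
    Submodule.span_le.2 fun f hf => by
      have := Submodule.neg_mem (V2 u) (face_subset_V2 u ((face_neg u).1 hf))
      simpa using this
  exact le_antisymm (h u) (by simpa using h (-u))

theorem V0_neg (hu : ‖u‖ = 1) : V0 (-u) = V0 u := by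
  have h : ∀ u : StrongDual ℝ Z, ‖u‖ = 1 → V0 (-u) ≤ V0 u := fun u hu f hf => by
    rw [mem_V0 (by simpa using hu)] at hf
    refine (mem_V0 hu).2 fun g hg => ?_
    have := (hf (-g) ((face_neg u).2 (by simpa using hg))).neg_left
    simpa using this
  exact le_antisymm (h u hu) (by simpa using h (-u) (by simpa using hu))

theorem sym_neg (hu : ‖u‖ = 1) (f : Z) : sym (-u) f = sym u f := by
  have hu' : ‖-u‖ = 1 := by simpa using hu
  refine involution_unique (sym_sym hu') (sym_sym hu) (fun g => ?_) f
  rw [sym_eq_iff hu', sym_eq_iff hu, V2_neg, V0_neg hu]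

/-- Isometries fixing a face pointwise commute with its symmetry. -/
theorem sym_comm_of_fixed (hu : ‖u‖ = 1) {R : Z ≃ₗᵢ[ℝ] Z} (hR : ∀ f ∈ face u, R f = f) (f : Z) :
    R (sym u f) = sym u (R f) := by
  have hR' : ∀ f ∈ face u, R.symm f = f := fun f hf => by
    rw [LinearIsometryEquiv.symm_apply_eq, hR f hf]
  have key : ∀ R : Z ≃ₗᵢ[ℝ] Z, (∀ f ∈ face u, R f = f) → ∀ f ∈ V2 u ⊔ V0 u, R f ∈ V2 u ⊔ V0 u := by
    intro R hR f hf
    obtain ⟨a, ha, b, hb, rfl⟩ := Submodule.mem_sup.1 hf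
    have hle : V2 u ≤ (V2 u).comap R.toLinearEquiv.toLinearMap := Submodule.span_le.2 fun g hg => by
      change R g ∈ V2 u
      rw [hR g hg]
      exact face_subset_V2 u hg
    have hRb : R b ∈ V0 u := (mem_V0 hu).2 fun g hg => by
      have := ((mem_V0 hu).1 hb g hg).map R
      rwa [hR g hg] at this
    rw [map_add]
    exact add_mem (Submodule.mem_sup_left (hle ha)) (Submodule.mem_sup_right hRb)
  have := involution_unique (S := (R.symm.trans (sym u)).trans R) (S' := sym u)
    (fun g => by simp [sym_sym hu]) (sym_sym hu) (fun g => ?_) (R f)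
  · simpa using this
  · rw [sym_eq_iff hu]
    simp only [LinearIsometryEquiv.trans_apply]
    rw [← LinearIsometryEquiv.eq_symm_apply, sym_eq_iff hu]
    refine ⟨fun h => ?_, key R.symm hR' g⟩
    simpa using key R hR _ h

end

section

variable {Z : Type*} [NormedAddCommGroup Z] [NormedSpace ℝ Z] [FiniteDimensional ℝ Z]
variable {u v w x : StrongDual ℝ Z}
variable [hS : Fact (IsSFS Z)] [hN : Fact (IsNeutral Z)]

theorem P2_eq_of_norm_le (hu : ‖u‖ = 1) {f : Z} (h : ‖f‖ ≤ ‖P2 u f‖) : P2 u f = f :=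
  hN.out _ (hS.out.1 _ (isNormExposedFace_face hu)) _ _ _ (isPeirce hu) f
    (le_antisymm (norm_P2_le hu f) h)

theorem face_subset_V2_of_apply (hu : ‖u‖ = 1) (hx : ‖x‖ ≤ 1) (h : ∀ f ∈ face x, x (P2 u f) = 1) :
    face x ⊆ V2 u := by
  intro f hf
  have h1 := le_norm_of_norm_le_one hx (P2 u f)
  rw [h f hf] at h1
  have := P2_eq_of_norm_le hu (hf.1.trans h1)
  rw [← this]
  exact P2_mem hu f

/-- Every norm exposed face is the face of a geometric tripotent. -/
theorem exists_tripotent (hx : ‖x‖ = 1) : ∃ w, IsGeometricTripotent w ∧ face w = face x := by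
  have hle : ‖pull (P2 x) x‖ ≤ 1 := norm_pull_le (norm_P2_le hx) hx.le
  have hsub : face x ⊆ face (pull (P2 x) x) := fun f hf =>
    ⟨hf.1, by rw [pull_apply, (P2_P0_of_mem_V2 hx (face_subset_V2 x hf)).1, hf.2]⟩
  have hface : face (pull (P2 x) x) = face x := by
    refine Set.Subset.antisymm (fun f hf => ?_) hsub
    have hf2 : x (P2 x f) = 1 := hf.2
    have := P2_eq_of_norm_le hx (hf.1.trans (hf2 ▸ le_norm_of_norm_le_one hx.le (P2 x f)))
    exact ⟨hf.1, by rwa [this] at hf2⟩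
  obtain ⟨f, hf⟩ := face_nonempty hx
  have hn := norm_eq_one_of_apply hle (hsub hf).1 (hsub hf).2
  refine ⟨_, isGeometricTripotent_iff.2 ⟨hn, fun g hg => ?_⟩, hface⟩
  have hg' : g ∈ V0 x := by rwa [V0, ← hface]
  rw [pull_apply, (P2_P0_of_mem_V0 hx hg').1, map_zero]

theorem IsGeometricTripotent.apply_P0_of_subset (hw : IsGeometricTripotent w) (hv : ‖v‖ = 1)
    (h : face w ⊆ V0 v) (f : Z) : w (P0 v f) = w f := by
  have h1 : w (sym v f) = w f := hw.apply_of_fixed (fun g hg => sym_of_mem_V0 hv (h hg)) f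
  have h2 : w (P2 v f) = 0 := hw.apply_V0 <| (mem_V0 hw.norm_eq).2 fun g hg =>
    (orth_of_mem hv (P2_mem hv f) (h hg)).symm
  conv_rhs => rw [peirce_decomp hv f]
  simp [h1, h2]

theorem IsGeometricTripotent.apply_P2_of_subset (hw : IsGeometricTripotent w) (hv : ‖v‖ = 1)
    (h : face w ⊆ V2 v) (f : Z) : w (P2 v f) = w f := by
  have h1 : w (sym v f) = w f := hw.apply_of_fixed (fun g hg => sym_of_mem_V2 hv (h hg)) f
  have h2 : w (P0 v f) = 0 := hw.apply_V0 <| (mem_V0 hw.norm_eq).2 fun g hg =>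
    orth_of_mem hv (h hg) (P0_mem hv f)
  conv_rhs => rw [peirce_decomp hv f]
  simp [h1, h2]

theorem P0_eq_of_norm_le (hu : ‖u‖ = 1) {f : Z} (h : ‖f‖ ≤ ‖P0 u f‖) : P0 u f = f := by
  rcases eq_or_ne f 0 with rfl | h0
  · simp
  have hn : ‖f‖ ≠ 0 := norm_ne_zero_iff.2 h0
  have hnorm : ‖P0 u f‖ = ‖f‖ := le_antisymm (norm_P0_le hu f) h
  have hg1 : ‖‖f‖⁻¹ • P0 u f‖ = 1 := by
    rw [norm_smul, norm_inv, norm_norm, hnorm, inv_mul_cancel₀ hn]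
  obtain ⟨x, hx, hgx, hF⟩ := exists_exposing hu hg1
    ((mem_V0 hu).1 ((V0 u).smul_mem ‖f‖⁻¹ (P0_mem hu f)))
  obtain ⟨w, hw, hwx⟩ := exists_tripotent hx
  have hsub : face w ⊆ V0 u := fun k hk => (mem_V0 hu).2 (hF k (hwx ▸ hk))
  have hwf : w (‖f‖⁻¹ • f) = 1 := by
    rw [← hw.apply_P0_of_subset hu hsub, map_smul]
    rw [← hwx] at hgx
    exact hgx.2
  have hmem : ‖f‖⁻¹ • f ∈ V0 u := hsub
    ⟨by rw [norm_smul, norm_inv, norm_norm, inv_mul_cancel₀ hn], hwf⟩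
  have := (V0 u).smul_mem ‖f‖ hmem
  rw [smul_inv_smul₀ hn] at this
  exact (P2_P0_of_mem_V0 hu this).2

theorem face_subset_V0_of_apply (hu : ‖u‖ = 1) (hx : ‖x‖ ≤ 1) (h : ∀ f ∈ face x, x (P0 u f) = 1) :
    face x ⊆ V0 u := by
  intro f hf
  have h1 := le_norm_of_norm_le_one hx (P0 u f)
  rw [h f hf] at h1
  have := P0_eq_of_norm_le hu (hf.1.trans h1)
  rw [← this]
  exact P0_mem hu f

theorem exists_functional_face_subset_V0 (T : Finset (StrongDual ℝ Z)) (hT : ∀ u ∈ T, ‖u‖ = 1)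
    {g : Z} (hg : ‖g‖ = 1) (hgT : ∀ u ∈ T, g ∈ V0 u) :
    ∃ x : StrongDual ℝ Z, ‖x‖ ≤ 1 ∧ x g = 1 ∧ ∀ u ∈ T, face x ⊆ V0 u := by
  classical
  induction T using Finset.induction_on with
  | empty =>
    obtain ⟨x, hx1, hx⟩ := exists_dual_vector'' ℝ g
    exact ⟨x, hx1, by rw [hx, hg]; rfl, by simp⟩
  | insert u T _ ih =>
    obtain ⟨x, hx1, hxg, hxT⟩ := ih (fun v hv => hT v (Finset.mem_insert_of_mem hv))
      (fun v hv => hgT v (Finset.mem_insert_of_mem hv))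
    have hu := hT u (Finset.mem_insert_self u T)
    have hgu := hgT u (Finset.mem_insert_self u T)
    have hle := norm_pull_le (norm_P0_le hu) hx1
    have hsub : face (pull (P0 u) x) ⊆ V0 u := face_subset_V0_of_apply hu hle fun f hf => by
      rw [pull_apply, (P2_P0_of_mem_V0 hu (P0_mem hu f)).2]
      exact hf.2
    refine ⟨pull (P0 u) x, hle, by rw [pull_apply, (P2_P0_of_mem_V0 hu hgu).2, hxg], ?_⟩
    intro v hv
    rcases Finset.mem_insert.1 hv with rfl | hv
    · exact hsub
    · refine fun f hf => hxT v hv ⟨hf.1, ?_⟩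
      have := hf.2
      rwa [pull_apply, (P2_P0_of_mem_V0 hu (hsub hf)).2] at this

theorem exists_tripotent_face_subset_V0 (T : Finset (StrongDual ℝ Z)) (hT : ∀ u ∈ T, ‖u‖ = 1)
    {g : Z} (hg : ‖g‖ = 1) (hgT : ∀ u ∈ T, g ∈ V0 u) :
    ∃ w : StrongDual ℝ Z, IsGeometricTripotent w ∧ g ∈ face w ∧ ∀ u ∈ T, face w ⊆ V0 u := by
  obtain ⟨x, hx1, hxg, hxT⟩ := exists_functional_face_subset_V0 T hT hg hgT
  obtain ⟨w, hw, hwx⟩ := exists_tripotent (norm_eq_one_of_apply hx1 hg.le hxg)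
  rw [← hwx] at hxT
  exact ⟨w, hw, hwx ▸ ⟨hg.le, hxg⟩, hxT⟩

theorem exists_tripotent_face_subset_V2_V0 (hv : ‖v‖ = 1) (T : Finset (StrongDual ℝ Z))
    (hT : ∀ u ∈ T, ‖u‖ = 1) {g : Z} (hg : ‖g‖ = 1) (hgv : g ∈ V2 v) (hgT : ∀ u ∈ T, g ∈ V0 u) :
    ∃ w : StrongDual ℝ Z, IsGeometricTripotent w ∧ face w ⊆ V2 v ∧ ∀ u ∈ T, face w ⊆ V0 u := by
  obtain ⟨x, hx1, hxg, hxT⟩ := exists_functional_face_subset_V0 T hT hg hgT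
  have hle := norm_pull_le (norm_P2_le hv) hx1
  have hpg : pull (P2 v) x g = 1 := by rw [pull_apply, (P2_P0_of_mem_V2 hv hgv).1, hxg]
  obtain ⟨w, hw, hwx⟩ := exists_tripotent (norm_eq_one_of_apply hle hg.le hpg)
  have hsub : face (pull (P2 v) x) ⊆ V2 v := face_subset_V2_of_apply hv hle fun f hf => by
    rw [pull_apply, (P2_P0_of_mem_V2 hv (P2_mem hv f)).1]
    exact hf.2
  rw [← hwx] at hsub
  refine ⟨w, hw, hsub, fun u hu f hf => hxT u hu ⟨hf.1, ?_⟩⟩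
  have h2 := P2_P0_of_mem_V2 hv (hsub hf)
  rw [hwx] at hf
  have := hf.2
  rwa [pull_apply, h2.1] at this

/-- Faces of `u` and `v` are orthogonal. -/
def FaceOrth (u v : StrongDual ℝ Z) : Prop := ∀ f ∈ face u, ∀ g ∈ face v, Orth f g

theorem FaceOrth.symm (h : FaceOrth u v) : FaceOrth v u := fun f hf g hg => (h g hg f hf).symm

theorem faceOrth_iff_left (hu : ‖u‖ = 1) : FaceOrth u v ↔ face v ⊆ V0 u :=
  ⟨fun h g hg => (mem_V0 hu).2 fun f hf => h f hf g hg,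
    fun h f hf _ hg => (mem_V0 hu).1 (h hg) f hf⟩

theorem faceOrth_iff_right (hv : ‖v‖ = 1) : FaceOrth u v ↔ face u ⊆ V0 v :=
  ⟨fun h => (faceOrth_iff_left hv).1 h.symm, fun h => ((faceOrth_iff_left hv).2 h).symm⟩

theorem FaceOrth.neg_right (h : FaceOrth u v) : FaceOrth u (-v) := fun f hf _ hg => by
  have := (h f hf _ ((face_neg v).1 hg)).neg_right
  simpa using this

theorem FaceOrth.apply_P0 (h : FaceOrth u v) (hu : IsGeometricTripotent u)
    (hv : ‖v‖ = 1) (f : Z) : u (P0 v f) = u f :=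
  hu.apply_P0_of_subset hv ((faceOrth_iff_right hv).1 h) f

theorem FaceOrth.apply_face (h : FaceOrth u v) (hu : IsGeometricTripotent u) {f : Z}
    (hf : f ∈ face v) : u f = 0 :=
  hu.apply_V0 ((faceOrth_iff_left hu.norm_eq).1 h hf)

theorem FaceOrth.ne (h : FaceOrth u v) (hu : IsGeometricTripotent u) : u ≠ v := by
  rintro rfl
  obtain ⟨f, hf⟩ := face_nonempty hu.norm_eq
  have := h.apply_face hu hf
  rw [hf.2] at this
  exact one_ne_zero this

theorem tripotentOrth_iff (hu : IsGeometricTripotent u) (hv : IsGeometricTripotent v) :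
    TripotentOrth u v ↔ FaceOrth u v := by
  constructor
  · rintro ⟨Q2, Q1, Q0, hQ, hQu⟩
    obtain ⟨S, hSym, hQ1⟩ := hQ.symmetry
    have hQ0 : ∀ f, Q0 f = P0 v f := fun f => by
      have h2 := hQ.two_mem f
      have h0 := hQ.zero_mem f
      rw [closedSpan_eq] at h2
      rw [← coe_V0 hv.norm_eq] at h0
      refine (P2_P0_of_add hv.norm_eq h2 h0 ?_).2.symm
      have h := hQ.sum_eq f
      rw [hQ1, hSym.eq_sym hv.norm_eq] at h
      rw [add_right_comm, ← eq_sub_iff_add_eq] at h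
      rw [h]
      module
    rw [faceOrth_iff_right hv.norm_eq]
    exact face_subset_V0_of_apply hv.norm_eq hu.norm_eq.le fun f hf => by
      rw [← hQ0, hQu, hf.2]
  · exact fun h => ⟨_, _, _, isPeirce hv.norm_eq, h.apply_P0 hu hv.norm_eq⟩

theorem FaceOrth.norm_add_eq (h : FaceOrth u v) (hu : IsGeometricTripotent u)
    (hv : IsGeometricTripotent v) : ‖u + v‖ = 1 ∧ face u ⊆ face (u + v) := by
  have hle : ‖u + v‖ ≤ 1 := by
    refine ContinuousLinearMap.opNorm_le_bound _ zero_le_one fun f => ?_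
    rw [add_apply, ← h.apply_P0 hu hv.norm_eq f, ← hv.apply_P2 f, one_mul]
    refine (norm_add_le _ _).trans ?_
    have h1 := u.le_of_opNorm_le hu.norm_eq.le (P0 v f)
    have h2 := v.le_of_opNorm_le hv.norm_eq.le (P2 v f)
    linarith [norm_P2_add_norm_P0_le hv.norm_eq f]
  have hsub : face u ⊆ face (u + v) := fun f hf =>
    ⟨hf.1, by rw [add_apply, hf.2, h.symm.apply_face hv hf, add_zero]⟩
  obtain ⟨f, hf⟩ := face_nonempty hu.norm_eq
  exact ⟨norm_eq_one_of_apply hle hf.1 (hsub hf).2, hsub⟩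

theorem mem_V0_of_face_subset (hu : ‖u‖ = 1) (hv : ‖v‖ = 1) (h : face u ⊆ face v) {g : Z}
    (hg : g ∈ V0 v) : g ∈ V0 u :=
  (mem_V0 hu).2 fun f hf => (mem_V0 hv).1 hg f (h hf)

theorem FaceOrth.add_tripotent (h : FaceOrth u v) (hu : IsGeometricTripotent u)
    (hv : IsGeometricTripotent v) : IsGeometricTripotent (u + v) := by
  have h1 := h.norm_add_eq hu hv
  have h2 := h.symm.norm_add_eq hv hu
  rw [add_comm v u] at h2
  refine isGeometricTripotent_iff.2 ⟨h1.1, fun f hf => ?_⟩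
  rw [add_apply,
    hu.apply_V0 (mem_V0_of_face_subset hu.norm_eq h1.1 h1.2 hf),
    hv.apply_V0 (mem_V0_of_face_subset hv.norm_eq h1.1 h2.2 hf), add_zero]

theorem FaceOrth.V0_add (h : FaceOrth u v) (hu : IsGeometricTripotent u)
    (hv : IsGeometricTripotent v) : V0 (u + v) = V0 u ⊓ V0 v := by
  classical
  have h1 := h.norm_add_eq hu hv
  have h2 := h.symm.norm_add_eq hv hu
  rw [add_comm v u] at h2
  refine le_antisymm (fun f hf => ⟨mem_V0_of_face_subset hu.norm_eq h1.1 h1.2 hf,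
    mem_V0_of_face_subset hv.norm_eq h1.1 h2.2 hf⟩) ?_
  rintro g ⟨hgu, hgv⟩
  rcases eq_or_ne g 0 with rfl | h0
  · exact zero_mem _
  have hn : ‖g‖ ≠ 0 := norm_ne_zero_iff.2 h0
  have hg1 : ‖‖g‖⁻¹ • g‖ = 1 := by rw [norm_smul, norm_inv, norm_norm, inv_mul_cancel₀ hn]
  obtain ⟨w, hw, hgw, hwT⟩ := exists_tripotent_face_subset_V0 {u, v}
    (by simp [hu.norm_eq, hv.norm_eq]) hg1
    (by simp only [Finset.mem_insert, Finset.mem_singleton, forall_eq_or_imp, forall_eq]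
        exact ⟨(V0 u).smul_mem _ hgu, (V0 v).smul_mem _ hgv⟩)
  have hwu : FaceOrth u w := (faceOrth_iff_left hu.norm_eq).2 (hwT u (by simp))
  have hwv : FaceOrth v w := (faceOrth_iff_left hv.norm_eq).2 (hwT v (by simp))
  have hsub : face (u + v) ⊆ V0 w := face_subset_V0_of_apply hw.norm_eq h1.1.le fun f hf => by
    rw [add_apply, hwu.apply_P0 hu hw.norm_eq, hwv.apply_P0 hv hw.norm_eq]
    exact hf.2
  have := (V0 (u + v)).smul_mem ‖g‖ ((faceOrth_iff_left h1.1).1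
    ((faceOrth_iff_right hw.norm_eq).2 hsub) hgw)
  rwa [smul_inv_smul₀ hn] at this

/-- The Peirce 2-space consists of the fixed vectors orthogonal to the Peirce 0-space. -/
theorem mem_V2_iff (hu : ‖u‖ = 1) {f : Z} :
    f ∈ V2 u ↔ sym u f = f ∧ ∀ g ∈ V0 u, Orth f g := by
  refine ⟨fun h => ⟨sym_of_mem_V2 hu h, fun g hg => orth_of_mem hu h hg⟩, fun ⟨h1, h2⟩ => ?_⟩
  obtain ⟨a, ha, b, hb, rfl⟩ := Submodule.mem_sup.1 ((sym_eq_iff hu).1 h1)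
  have h3 := (h2 b hb).2
  have h4 := (orth_of_mem hu ha hb).1
  rw [add_sub_cancel_right, h4] at h3
  have : b = 0 := norm_eq_zero.1 (by linarith [norm_nonneg b])
  rwa [this, add_zero]

variable [hJ : Fact (HasJP Z)]

theorem FaceOrth.sym_add (h : FaceOrth u v) (hu : IsGeometricTripotent u)
    (hv : IsGeometricTripotent v) (f : Z) : sym u (sym v f) = sym (u + v) f :=
  hJ.out u v hu hv ((tripotentOrth_iff hu hv).2 h) _ _ _ (isSymmetryOf_sym hu.norm_eq)
    (isSymmetryOf_sym hv.norm_eq) (isSymmetryOf_sym (h.norm_add_eq hu hv).1) f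

theorem FaceOrth.V2_sub (h : FaceOrth u v) (hu : IsGeometricTripotent u)
    (hv : IsGeometricTripotent v) : V2 (u - v) = V2 (u + v) := by
  have h' := h.neg_right
  have hs : ∀ f, sym (u - v) f = sym (u + v) f := fun f => by
    rw [sub_eq_add_neg, ← h'.sym_add hu hv.neg, ← h.sym_add hu hv, sym_neg hv.norm_eq]
  have h0 : V0 (u - v) = V0 (u + v) := by
    rw [sub_eq_add_neg, h'.V0_add hu hv.neg, h.V0_add hu hv, V0_neg hv.norm_eq]
  ext f
  have hn' := (h'.norm_add_eq hu hv.neg).1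
  rw [← sub_eq_add_neg] at hn'
  rw [mem_V2_iff hn', mem_V2_iff (h.norm_add_eq hu hv).1, hs, h0]

end

section

variable {Z : Type*} [NormedAddCommGroup Z] [NormedSpace ℝ Z] [FiniteDimensional ℝ Z]

/-- A finite set of geometric tripotents with pairwise orthogonal faces. -/
def OrthFinset (T : Finset (StrongDual ℝ Z)) : Prop :=
  (∀ u ∈ T, IsGeometricTripotent u) ∧ ∀ u ∈ T, ∀ v ∈ T, u ≠ v → FaceOrth u v

variable {u v w x : StrongDual ℝ Z} {T : Finset (StrongDual ℝ Z)}

theorem OrthFinset.mono {T' : Finset (StrongDual ℝ Z)} (hT : OrthFinset T) (h : T' ⊆ T) :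
    OrthFinset T' := ⟨fun u hu => hT.1 u (h hu), fun u hu v hv => hT.2 u (h hu) v (h hv)⟩

variable [hS : Fact (IsSFS Z)] [hN : Fact (IsNeutral Z)]

open Classical in
theorem OrthFinset.insert (hT : OrthFinset T) (hw : IsGeometricTripotent w)
    (h : ∀ u ∈ T, FaceOrth u w) : OrthFinset (insert w T) := by
  constructor
  · intro u hu
    rcases Finset.mem_insert.1 hu with rfl | hu
    exacts [hw, hT.1 u hu]
  · intro u hu v hv huv
    rcases Finset.mem_insert.1 hu with rfl | hu' <;> rcases Finset.mem_insert.1 hv with rfl | hv'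
    exacts [absurd rfl huv, (h v hv').symm, h u hu', hT.2 u hu' v hv' huv]

theorem OrthFinset.sum_abs_le (hT : OrthFinset T) (f : Z) : ∑ u ∈ T, |u f| ≤ ‖f‖ := by
  classical
  induction T using Finset.induction_on generalizing f with
  | empty => simp
  | insert u T hu ih =>
    have huT := hT.1 u (Finset.mem_insert_self u T)
    have hn := huT.norm_eq
    rw [Finset.sum_insert hu]
    have h1 : ∑ v ∈ T, |v f| = ∑ v ∈ T, |v (P0 u f)| := by
      refine Finset.sum_congr rfl fun v hv => ?_
      have hvT := Finset.mem_insert_of_mem (a := v) (b := u) hv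
      rw [(hT.2 v hvT u (Finset.mem_insert_self u T) (by rintro rfl; exact hu hv)).apply_P0
        (hT.1 v hvT) hn]
    have h2 := ih (hT.mono (Finset.subset_insert u T)) (P0 u f)
    have h3 : |u f| ≤ ‖P2 u f‖ := by
      rw [← huT.apply_P2]
      have := u.le_of_opNorm_le hn.le (P2 u f)
      rwa [one_mul] at this
    rw [h1]
    linarith [norm_P2_add_norm_P0_le hn f]

theorem OrthFinset.card_le (hT : OrthFinset T) : T.card ≤ Module.finrank ℝ Z := by
  classical
  choose! e he using fun u (hu : u ∈ T) => face_nonempty (hT.1 u hu).norm_eq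
  have hli : LinearIndependent ℝ (fun u : T => e u) := by
    rw [Fintype.linearIndependent_iff]
    intro c hc u
    have := congrArg (u : StrongDual ℝ Z) hc
    rw [map_sum, map_zero, Finset.sum_eq_single u] at this
    · simpa [(he u u.2).2] using this
    · intro v _ hvu
      have hne : (u : StrongDual ℝ Z) ≠ v := fun h => hvu (Subtype.ext h.symm)
      rw [map_smul, (hT.2 u u.2 v v.2 hne).apply_face (hT.1 u u.2) (he v v.2), smul_zero]
    · simp
  simpa using hli.fintype_card_le_finrank

theorem OrthFinset.sum_tripotent (hT : OrthFinset T) (hne : T.Nonempty) :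
    IsGeometricTripotent (∑ u ∈ T, u) ∧ ∀ f, f ∈ V0 (∑ u ∈ T, u) ↔ ∀ u ∈ T, f ∈ V0 u := by
  classical
  induction hne using Finset.Nonempty.cons_induction with
  | singleton a => simpa using hT.1 a (by simp)
  | cons a s ha hs ih =>
    rw [Finset.cons_eq_insert] at hT
    obtain ⟨h1, h2⟩ := ih (hT.mono (Finset.subset_insert a s))
    have haT := hT.1 a (Finset.mem_insert_self a s)
    have ho : FaceOrth a (∑ u ∈ s, u) := by
      refine (faceOrth_iff_right h1.norm_eq).2 fun f hf => (h2 f).2 fun u hu => ?_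
      have huT := Finset.mem_insert_of_mem (a := u) (b := a) hu
      exact (faceOrth_iff_right (hT.1 u huT).norm_eq).1
        (hT.2 a (Finset.mem_insert_self a s) u huT (by rintro rfl; exact ha hu)) hf
    rw [Finset.sum_cons]
    refine ⟨ho.add_tripotent haT h1, fun f => ?_⟩
    rw [ho.V0_add haT h1, Submodule.mem_inf, h2]
    simp

end

section

variable {Z : Type*} [NormedAddCommGroup Z] [NormedSpace ℝ Z] [FiniteDimensional ℝ Z]
variable {u v w x y : StrongDual ℝ Z} {T : Finset (StrongDual ℝ Z)}
variable [hS : Fact (IsSFS Z)]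

/-- The functionals which factor through the Peirce 2-projection of `y`. -/
noncomputable def dualV2 (y : StrongDual ℝ Z) : Submodule ℝ (StrongDual ℝ Z) where
  carrier := {φ | ∀ f, φ (P2 y f) = φ f}
  add_mem' ha hb f := by simp [ha f, hb f]
  zero_mem' f := by simp
  smul_mem' c φ h f := by simp [h f]

variable [hN : Fact (IsNeutral Z)]

theorem exists_spectral (hy : ‖y‖ = 1) {φ : StrongDual ℝ Z} (hφ : φ ∈ dualV2 y) :
    ∃ T : Finset (StrongDual ℝ Z), OrthFinset T ∧ (∀ u ∈ T, face u ⊆ V2 y) ∧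
      φ ∈ Submodule.span ℝ (T : Set (StrongDual ℝ Z)) ∧
      ∀ g ∈ V2 y, (∀ u ∈ T, g ∈ V0 u) → g = 0 := by
  classical
  let P : Finset (StrongDual ℝ Z) → Prop := fun T => OrthFinset T ∧ (∀ u ∈ T, face u ⊆ V2 y) ∧
    ∃ φ₀ ∈ dualV2 y, φ - φ₀ ∈ Submodule.span ℝ (T : Set (StrongDual ℝ Z)) ∧
      ∀ u ∈ T, ∀ f, φ₀ (P0 u f) = φ₀ f
  obtain ⟨T, ⟨hT, hTy, φ₀, hφ₀, hspan, hφT⟩, hmax⟩ := exists_maximal_card (P := P)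
    (N := Module.finrank ℝ Z)
    ⟨∅, ⟨by simp, by simp⟩, by simp, φ, hφ, by simp, by simp⟩ (fun T hT => hT.1.card_le)
  have hnot : ∀ w, IsGeometricTripotent w → (∀ u ∈ T, FaceOrth u w) → ¬ P (insert w T) := by
    intro w hw ho hP
    have h1 := hmax _ hP
    rw [Finset.card_insert_of_notMem fun h => (ho w h).ne hw rfl] at h1
    omega
  have h0 : φ₀ = 0 := by
    by_contra hne
    have hn : ‖φ₀‖ ≠ 0 := norm_ne_zero_iff.2 hne
    set x := ‖φ₀‖⁻¹ • φ₀ with hx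
    have hφx : φ₀ = ‖φ₀‖ • x := by rw [hx, smul_inv_smul₀ hn]
    have hx1 : ‖x‖ = 1 := by rw [hx, norm_smul, norm_inv, norm_norm, inv_mul_cancel₀ hn]
    obtain ⟨w, hw, hwx⟩ := exists_tripotent hx1
    have hxy : face x ⊆ V2 y := face_subset_V2_of_apply hy hx1.le fun f hf => by
      rw [← hf.2, hx]
      simp [hφ₀ f]
    have hxT : ∀ u ∈ T, face x ⊆ V0 u := fun u hu =>
      face_subset_V0_of_apply (hT.1 u hu).norm_eq hx1.le fun f hf => by
        rw [← hf.2, hx]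
        simp [hφT u hu f]
    have hwT : ∀ u ∈ T, FaceOrth u w := fun u hu =>
      (faceOrth_iff_left (hT.1 u hu).norm_eq).2 (hwx ▸ hxT u hu)
    refine hnot w hw hwT ⟨hT.insert hw hwT, ?_, φ₀ - ‖φ₀‖ • w, ?_, ?_, ?_⟩
    · intro u hu
      rcases Finset.mem_insert.1 hu with rfl | hu'
      exacts [hwx ▸ hxy, hTy u hu']
    · exact sub_mem hφ₀ (Submodule.smul_mem _ _ (hw.apply_P2_of_subset hy (hwx ▸ hxy)))
    · have : φ - (φ₀ - ‖φ₀‖ • w) = (φ - φ₀) + ‖φ₀‖ • w := by abel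
      rw [this]
      refine add_mem (Submodule.span_mono (by simp) hspan) (Submodule.smul_mem _ _ ?_)
      exact Submodule.subset_span (by simp)
    · intro u hu f
      rcases Finset.mem_insert.1 hu with rfl | hu'
      · have h1 : φ₀ (sym u f) = φ₀ f := by
          rw [hφx]
          simp [apply_sym_of_face_subset hw.norm_eq hx1 hwx.subset f]
        have h2 : φ₀ (P2 u f) = ‖φ₀‖ * u f := by
          rw [← hw.apply_P2 f, eqOn_span_face hwx.subset (P2_mem hw.norm_eq f)]
          conv_lhs => rw [hφx]
          simp
        have h3 : φ₀ f = φ₀ (P2 u f) + φ₀ (P0 u f) := by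
          conv_lhs => rw [peirce_decomp hw.norm_eq f]
          simp [h1]
        simp only [sub_apply, smul_apply, smul_eq_mul,
          hw.apply_V0 (P0_mem hw.norm_eq f)]
        linarith
      · simp [hφT u hu' f, (hwT u hu').symm.apply_P0 hw (hT.1 u hu').norm_eq f]
  subst h0
  refine ⟨T, hT, hTy, by simpa using hspan, fun g hg hgT => ?_⟩
  by_contra hg0
  have hn : ‖g‖ ≠ 0 := norm_ne_zero_iff.2 hg0
  have hg1 : ‖‖g‖⁻¹ • g‖ = 1 := by rw [norm_smul, norm_inv, norm_norm, inv_mul_cancel₀ hn]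
  obtain ⟨w, hw, hwy, hwT⟩ := exists_tripotent_face_subset_V2_V0 hy T
    (fun u hu => (hT.1 u hu).norm_eq) hg1 ((V2 y).smul_mem _ hg)
    (fun u hu => (V0 u).smul_mem _ (hgT u hu))
  have hwT' : ∀ u ∈ T, FaceOrth u w := fun u hu =>
    (faceOrth_iff_left (hT.1 u hu).norm_eq).2 (hwT u hu)
  refine hnot w hw hwT' ⟨hT.insert hw hwT', ?_, 0, zero_mem _, ?_, by simp⟩
  · intro u hu
    rcases Finset.mem_insert.1 hu with rfl | hu'
    exacts [hwy, hTy u hu']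
  · exact Submodule.span_mono (by simp) hspan

theorem countable_tripotents_of_V2_eq (X : Submodule ℝ Z) :
    {m : StrongDual ℝ Z | IsGeometricTripotent m ∧ V2 m = X}.Countable := by
  let C : StrongDual ℝ Z → Set X := fun m => {x | m x = ‖x‖}
  refine Set.PairwiseDisjoint.countable_of_isOpen (s := fun m => interior (C m)) ?_
    (fun m _ => isOpen_interior) ?_
  · rintro m ⟨hm, rfl⟩ m' ⟨hm', hX⟩ hne
    refine Set.disjoint_left.2 fun x hx hx' => hne ?_
    let ψ : V2 m →ₗ[ℝ] ℝ := (m - m' : StrongDual ℝ Z).toLinearMap ∘ₗ (V2 m).subtype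
    have hker : interior (C m) ∩ interior (C m') ⊆ LinearMap.ker ψ := fun z hz => by
      have h1 : m z = ‖z‖ := interior_subset (s := C m) hz.1
      have h2 : m' z = ‖z‖ := interior_subset (s := C m') hz.2
      change m z - m' z = 0
      rw [h1, h2, sub_self]
    have htop : LinearMap.ker ψ = ⊤ := Submodule.eq_top_of_nonempty_interior' _
      ⟨x, interior_maximal hker (isOpen_interior.inter isOpen_interior) ⟨hx, hx'⟩⟩
    have heq : ∀ z ∈ V2 m, m z = m' z := fun z hz => by
      have : ψ ⟨z, hz⟩ = 0 := by rw [← LinearMap.mem_ker, htop]; trivial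
      exact sub_eq_zero.1 this
    refine hm.ext_face hm' (Set.Subset.antisymm (fun f hf => ⟨hf.1, ?_⟩) fun f hf => ⟨hf.1, ?_⟩)
    · rw [← heq f (face_subset_V2 m hf), hf.2]
    · rw [heq f (hX ▸ face_subset_V2 m' hf), hf.2]
  · rintro m ⟨hm, rfl⟩
    have hconv : Convex ℝ (C m) := by
      intro a ha b hb s t hs ht _
      have ha' : m a = ‖a‖ := ha
      have hb' : m b = ‖b‖ := hb
      refine le_antisymm (le_norm_of_norm_le_one hm.norm_eq.le _) ?_
      refine (norm_add_le _ _).trans ?_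
      simp [norm_smul, ha', hb', abs_of_nonneg hs, abs_of_nonneg ht]
    rw [hconv.interior_nonempty_iff_affineSpan_eq_top]
    have hsub : insert 0 ((↑) ⁻¹' face m : Set (V2 m)) ⊆ C m := by
      rintro z (rfl | hz)
      · simp [C]
      · change m z = ‖(z : Z)‖
        rw [hz.2, norm_of_mem_face hm.norm_eq.le hz]
    have hspan : affineSpan ℝ (insert 0 ((↑) ⁻¹' face m : Set (V2 m))) = ⊤ := by
      refine SetLike.coe_injective ?_
      rw [affineSpan_insert_zero]
      have : Submodule.span ℝ ((↑) ⁻¹' face m : Set (V2 m)) = ⊤ :=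
        Submodule.span_span_coe_preimage
      rw [this]
      rfl
    exact top_le_iff.1 (hspan ▸ affineSpan_mono ℝ hsub)

variable [hJ : Fact (HasJP Z)]

theorem OrthFinset.sub_two_smul (hT : OrthFinset T) (hu : u ∈ T) :
    IsGeometricTripotent (∑ v ∈ T, v - (2 : ℝ) • u) ∧
      V2 (∑ v ∈ T, v - (2 : ℝ) • u) = V2 (∑ v ∈ T, v) := by
  classical
  have huT := hT.1 u hu
  rw [← Finset.add_sum_erase T (fun v => v) hu]
  rcases (T.erase u).eq_empty_or_nonempty with he | hne
  · have : u - (2 : ℝ) • u = -u := by module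
    rw [he, Finset.sum_empty, add_zero, this]
    exact ⟨huT.neg, V2_neg u⟩
  · obtain ⟨h1, h2⟩ := (hT.mono (T.erase_subset u)).sum_tripotent hne
    set r := ∑ v ∈ T.erase u, v
    have ho : FaceOrth r u := (faceOrth_iff_left h1.norm_eq).2 fun f hf => (h2 f).2 fun v hv => by
      rw [Finset.mem_erase] at hv
      exact (faceOrth_iff_left (hT.1 v hv.2).norm_eq).1 (hT.2 v hv.2 u hu hv.1) hf
    have : u + r - (2 : ℝ) • u = r - u := by module
    rw [this, add_comm u r]
    refine ⟨?_, ho.V2_sub h1 huT⟩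
    rw [sub_eq_add_neg]
    exact ho.neg_right.add_tripotent h1 huT.neg

theorem OrthFinset.face_subset_face_sum (hT : OrthFinset T) (hu : u ∈ T) :
    face u ⊆ face (∑ v ∈ T, v) := by
  intro f hf
  refine ⟨hf.1, ?_⟩
  rw [sum_apply, Finset.sum_eq_single u]
  · exact hf.2
  · exact fun v hv hvu => (hT.2 v hv u hu hvu).apply_face (hT.1 v hv) hf
  · exact fun h => absurd hu h

theorem exists_dualV2_le_span (hy : IsGeometricTripotent y) :
    ∃ T : Finset (StrongDual ℝ Z), OrthFinset T ∧ (∀ u ∈ T, face u ⊆ V2 y) ∧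
      dualV2 y ≤ Submodule.span ℝ (T : Set (StrongDual ℝ Z)) := by
  classical
  obtain ⟨B, hBsymm, hBpos, hBinv⟩ := exists_invariant_form (StrongDual ℝ Z)
  have hy1 := hy.norm_eq
  set M : Set (StrongDual ℝ Z) := {m | IsGeometricTripotent m ∧ V2 m = V2 y} with hM
  have hMc : M.Countable := countable_tripotents_of_V2_eq (V2 y)
  have hMD : ∀ m ∈ M, m ∈ dualV2 y := fun m hm =>
    hm.1.apply_P2_of_subset hy1 (hm.2 ▸ face_subset_V2 m)
  let Q : Submodule ℝ (StrongDual ℝ Z) → Prop := fun W => ∃ T : Finset (StrongDual ℝ Z),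
    OrthFinset T ∧ (∀ u ∈ T, face u ⊆ V2 y) ∧ W ≤ Submodule.span ℝ (T : Set (StrongDual ℝ Z))
  let C₁ : Set (Submodule ℝ (StrongDual ℝ Z)) :=
    Submodule.span ℝ '' {N : Set (StrongDual ℝ Z) | N.Finite ∧ N ⊆ M} ∩ {W | Q W}
  let C₂ : Set (Submodule ℝ (StrongDual ℝ Z)) := (fun m => LinearMap.ker (B (y - m))) '' (M \ {y})
  have hC₁ : C₁.Countable :=
    ((Set.countable_ofPred_finite_subset hMc).image _).mono Set.inter_subset_left
  have hC₂ : C₂.Countable := (hMc.mono Set.sdiff_subset).image _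
  suffices hcover : ∀ φ ∈ dualV2 y, ∃ W ∈ C₁ ∪ C₂, φ ∈ W by
    obtain ⟨W, hW, hDW⟩ := exists_le_of_countable_cover (dualV2 y) (hC₁.union hC₂) hcover
    · rcases hW with ⟨-, T, hT, hTy, hWT⟩ | ⟨m, ⟨hmM, hmy⟩, rfl⟩
      · exact ⟨T, hT, hTy, hDW.trans hWT⟩
      · have hmem : y - m ∈ dualV2 y := sub_mem (hMD y ⟨hy, rfl⟩) (hMD m hmM)
        have h0 : B (y - m) (y - m) = 0 := hDW hmem
        exact absurd h0 (hBpos _ (sub_ne_zero.2 fun h => hmy h.symm)).ne'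
  intro φ hφ
  obtain ⟨T, hT, hTy, hφT, hT0⟩ := exists_spectral hy1 hφ
  have hTne : T.Nonempty := by
    rw [Finset.nonempty_iff_ne_empty]
    rintro rfl
    obtain ⟨f, hf⟩ := face_nonempty hy1
    have hf0 := hT0 f (face_subset_V2 y hf) (by simp)
    have := hf.2
    simp [hf0] at this
  obtain ⟨hs, hsV0⟩ := hT.sum_tripotent hTne
  set s := ∑ u ∈ T, u with hsdef
  have hs1 := hs.norm_eq
  have hsy : face s ⊆ V2 y := face_subset_V2_of_apply hy1 hs1.le fun f hf => by
    rw [← hf.2, hsdef, sum_apply, sum_apply]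
    exact Finset.sum_congr rfl fun u hu => (hT.1 u hu).apply_P2_of_subset hy1 (hTy u hu) f
  have hsV2 : V2 s ≤ V2 y := Submodule.span_le.2 hsy
  have hinv : ∀ f ∈ V2 y, sym s f ∈ V2 y := by
    intro f hf
    rw [mem_V2_iff hy1] at hf ⊢
    refine ⟨?_, fun g hg => ?_⟩
    · rw [sym_comm_of_fixed hs1 fun g hg => sym_of_mem_V2 hy1 (hsy hg), hf.1]
    · have hgs : g ∈ V0 s := (mem_V0 hs1).2 fun k hk => orth_of_mem hy1 (hsy hk) hg
      have := (hf.2 g hg).map (sym s)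
      rwa [sym_of_mem_V0 hs1 hgs] at this
  set m := dualIsometry (sym s) y with hm
  have hmV2 : V2 m = V2 y := by
    refine le_antisymm (Submodule.span_le.2 fun f hf => ?_) ?_
    · have := hinv _ (face_subset_V2 y ((mem_face_dualIsometry _).1 hf))
      rwa [sym_sym hs1] at this
    · have hle : V2 y ≤ (V2 m).comap (sym s).toLinearEquiv.toLinearMap :=
        Submodule.span_le.2 fun f hf => face_subset_V2 m <| (mem_face_dualIsometry _).2 <| by
          change sym s (sym s f) ∈ face y
          rwa [sym_sym hs1]
      intro f hf
      have : sym s (sym s f) ∈ V2 m := hle (hinv f hf)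
      rwa [sym_sym hs1] at this
  have hmM : m ∈ M := ⟨hy.dualIsometry _, hmV2⟩
  by_cases hmy : m = y
  · have hyV2 : V2 s = V2 y := by
      refine le_antisymm hsV2 (Submodule.span_le.2 fun f hf => ?_)
      have hfy := face_subset_V2 y hf
      have h0 : P0 s f = 0 := by
        refine hT0 _ ?_ ((hsV0 _).1 (P0_mem hs1 f))
        have : P0 s f = f - P2 s f - (1 / 2 : ℝ) • (f - sym s f) := by
          conv_rhs => enter [1, 1]; rw [peirce_decomp hs1 f]
          abel
        rw [this]
        exact sub_mem (sub_mem hfy (hsV2 (P2_mem hs1 f)))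
          (Submodule.smul_mem _ _ (sub_mem hfy (hinv f hfy)))
      have h1 : y (sym s f) = y f := DFunLike.congr_fun hmy f
      have h2 : y (P2 s f) = 1 := by
        have : y f = y (P2 s f) := by
          conv_lhs => rw [peirce_decomp hs1 f]
          simp [h0, h1]
        rw [← this, hf.2]
      rw [← P2_eq_of_norm_le hs1 (hf.1.trans (h2 ▸ le_norm_of_norm_le_one hy1.le (P2 s f)))]
      exact P2_mem hs1 f
    refine ⟨Submodule.span ℝ (insert s ((fun u => s - (2 : ℝ) • u) '' (T : Set (StrongDual ℝ Z)))),
      Or.inl ⟨⟨_, ⟨(T.finite_toSet.image _).insert _, ?_⟩, rfl⟩, T, hT, hTy, ?_⟩, ?_⟩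
    · rintro _ (rfl | ⟨u, hu, rfl⟩)
      · exact ⟨hs, hyV2⟩
      · obtain ⟨h1, h2⟩ := hT.sub_two_smul hu
        exact ⟨h1, h2.trans hyV2⟩
    · have hsT : s ∈ Submodule.span ℝ (T : Set (StrongDual ℝ Z)) :=
        sum_mem fun u hu => Submodule.subset_span hu
      refine Submodule.span_le.2 ?_
      rintro _ (rfl | ⟨u, hu, rfl⟩)
      · exact hsT
      · exact sub_mem hsT (Submodule.smul_mem _ _ (Submodule.subset_span hu))
    · refine Submodule.span_le.2 (fun u hu => ?_) hφT
      have : u = (1 / 2 : ℝ) • (s - (s - (2 : ℝ) • u)) := by module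
      rw [this]
      exact Submodule.smul_mem _ _ (sub_mem (Submodule.subset_span (by simp))
        (Submodule.subset_span (Or.inr ⟨u, hu, rfl⟩)))
  · refine ⟨_, Or.inr ⟨m, ⟨hmM, hmy⟩, rfl⟩, ?_⟩
    have hφs : dualIsometry (sym s) φ = φ := by
      refine Submodule.span_induction (p := fun ψ _ => dualIsometry (sym s) ψ = ψ) ?_ (map_zero _)
        (fun a b _ _ ha hb => by rw [map_add, ha, hb]) (fun c a _ ha => by rw [map_smul, ha]) hφT
      intro u hu
      ext f
      exact (hT.1 u hu).apply_of_fixed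
        (fun g hg => sym_of_mem_V2 hs1 (face_subset_V2 s (hT.face_subset_face_sum hu hg))) f
    have hmm : dualIsometry (sym s) m = y := by
      ext f
      simp [hm, sym_sym hs1]
    have h1 := hBinv (dualIsometry (sym s)) (y - m) φ
    rw [map_sub, hmm, hφs, ← hm] at h1
    rw [LinearMap.mem_ker]
    have h2 : B (m - y) φ = -B (y - m) φ := by rw [← neg_sub, map_neg]; rfl
    linarith

end

section

variable {Z : Type*} [NormedAddCommGroup Z] [NormedSpace ℝ Z] [FiniteDimensional ℝ Z]
variable {u v w x y : StrongDual ℝ Z} {T : Finset (StrongDual ℝ Z)}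

/-- A geometric tripotent whose face is a single point. -/
def IsAtom (u : StrongDual ℝ Z) : Prop := IsGeometricTripotent u ∧ ∃ e, face u = {e}

theorem eq_zero_of_eq_neg {f : Z} (h : f = -f) : f = 0 := by
  have h2 : (2 : ℝ) • f = 0 := by
    rw [two_smul]
    nth_rewrite 1 [h]
    exact neg_add_cancel f
  simpa using h2

variable [hS : Fact (IsSFS Z)]

theorem IsAtom.neg (h : IsAtom u) : IsAtom (-u) := by
  obtain ⟨hu, e, he⟩ := h
  refine ⟨hu.neg, -e, ?_⟩
  ext f
  rw [face_neg, he, Set.mem_singleton_iff, Set.mem_singleton_iff, neg_eq_iff_eq_neg]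

variable [hN : Fact (IsNeutral Z)] [hJ : Fact (HasJP Z)]

theorem FaceOrth.V2_le_V0 (h : FaceOrth u v) (hu : ‖u‖ = 1) : V2 v ≤ V0 u :=
  Submodule.span_le.2 ((faceOrth_iff_left hu).1 h)

/-- Every geometric tripotent is a sum of orthogonal atoms, whose faces span its Peirce 2-space. -/
theorem exists_atoms (hy : IsGeometricTripotent y) : ∃ T : Finset (StrongDual ℝ Z),
    OrthFinset T ∧ (∀ u ∈ T, IsAtom u) ∧ y = ∑ u ∈ T, u ∧
      V2 y ≤ Submodule.span ℝ {f | ∃ u ∈ T, f ∈ face u} := by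
  classical
  obtain ⟨T, hT, hTy, hD⟩ := exists_dualV2_le_span hy
  have hy1 := hy.norm_eq
  have hsep : ∀ f ∈ V2 y, ∀ g ∈ V2 y, (∀ u ∈ T, u f = u g) → f = g := by
    intro f hf g hg h
    obtain ⟨ψ, -, hψ⟩ := exists_dual_vector'' ℝ (f - g)
    have hmem : pull (P2 y) ψ ∈ dualV2 y := fun k => by
      simp [(P2_P0_of_mem_V2 hy1 (P2_mem hy1 k)).1]
    have h0 : pull (P2 y) ψ (f - g) = 0 :=
      Submodule.span_induction (p := fun χ _ => χ (f - g) = 0)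
        (fun u hu => by rw [map_sub, h u hu, sub_self]) (by simp)
        (fun a b _ _ ha hb => by rw [add_apply, ha, hb, add_zero])
        (fun c a _ ha => by rw [smul_apply, ha, smul_zero]) (hD hmem)
    rw [pull_apply, (P2_P0_of_mem_V2 hy1 (sub_mem hf hg)).1, hψ] at h0
    exact sub_eq_zero.1 (norm_eq_zero.1 h0)
  choose! e he using fun u (hu : u ∈ T) => face_nonempty (hT.1 u hu).norm_eq
  have hdelta : ∀ u ∈ T, ∀ v ∈ T, u ≠ v → u (e v) = 0 := fun u hu v hv huv =>
    (hT.2 u hu v hv huv).apply_face (hT.1 u hu) (he v hv)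
  have hface : ∀ u ∈ T, face u = {e u} := fun u hu => by
    refine Set.eq_singleton_iff_unique_mem.2 ⟨he u hu, fun f hf => ?_⟩
    refine hsep f (hTy u hu hf) _ (hTy u hu (he u hu)) fun v hv => ?_
    rcases eq_or_ne v u with rfl | hvu
    · rw [hf.2, (he v hv).2]
    · rw [hdelta v hv u hu hvu, (hT.2 v hv u hu hvu).apply_face (hT.1 v hv) hf]
  have hexp : ∀ f ∈ V2 y, f = ∑ u ∈ T, u f • e u := fun f hf => by
    refine hsep f hf _ (sum_mem fun u hu => (V2 y).smul_mem _ (hTy u hu (he u hu))) fun v hv => ?_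
    rw [map_sum, Finset.sum_eq_single v]
    · simp [(he v hv).2]
    · intro u hu huv
      rw [map_smul, hdelta v hv u hu huv.symm, smul_zero]
    · exact fun h => absurd hv h
  have hysum : ∀ f, y f = ∑ u ∈ T, y (e u) * u f := fun f => by
    rw [← hy.apply_P2 f]
    conv_lhs => rw [hexp _ (P2_mem hy1 f), map_sum]
    refine Finset.sum_congr rfl fun u hu => ?_
    rw [map_smul, (hT.1 u hu).apply_P2_of_subset hy1 (hTy u hu), smul_eq_mul, mul_comm]
  have habs : ∀ u ∈ T, |y (e u)| ≤ 1 := fun u hu => by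
    have := y.le_of_opNorm_le hy1.le (e u)
    rw [one_mul] at this
    exact this.trans (he u hu).1
  have hsign : ∀ u ∈ T, y (e u) = 1 ∨ y (e u) = -1 := by
    intro u hu
    have hterm : ∀ f ∈ face y, ∀ v ∈ T, y (e v) * v f = |v f| := by
      intro f hf
      refine (Finset.sum_eq_sum_iff_of_le fun v hv => ?_).1 ?_
      · refine (le_abs_self _).trans ?_
        rw [abs_mul]
        exact mul_le_of_le_one_left (abs_nonneg _) (habs v hv)
      · refine le_antisymm (Finset.sum_le_sum fun v hv => ?_) ?_
        · refine (le_abs_self _).trans ?_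
          rw [abs_mul]
          exact mul_le_of_le_one_left (abs_nonneg _) (habs v hv)
        · rw [← hysum, hf.2]
          exact (hT.sum_abs_le f).trans hf.1
    have hex : ∃ f ∈ face y, u f ≠ 0 := by
      by_contra! hcon
      have hle : V2 y ≤ LinearMap.ker (u : Z →ₗ[ℝ] ℝ) := Submodule.span_le.2 fun f hf => hcon f hf
      have : u (e u) = 0 := hle (hTy u hu (he u hu))
      rw [(he u hu).2] at this
      exact one_ne_zero this
    obtain ⟨f, hf, hf0⟩ := hex
    have h1 := congrArg abs (hterm f hf u hu)
    rw [abs_mul, abs_abs, mul_eq_right₀ (abs_ne_zero.2 hf0)] at h1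
    exact eq_or_eq_neg_of_abs_eq h1
  have hinj : Set.InjOn (fun u => y (e u) • u) (T : Set (StrongDual ℝ Z)) := by
    intro u hu v hv huv
    by_contra hne
    have := DFunLike.congr_fun huv (e u)
    simp only [smul_apply] at this
    rw [hdelta v hv u hu (Ne.symm hne), (he u hu).2] at this
    rcases hsign u hu with h | h <;> simp [h] at this
  have hneg : ∀ v : StrongDual ℝ Z, (-1 : ℝ) • v = -v := fun v => by ext; simp
  refine ⟨T.image fun u => y (e u) • u, ⟨?_, ?_⟩, ?_, ?_, ?_⟩
  · intro v hv
    obtain ⟨u, hu, rfl⟩ := Finset.mem_image.1 hv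
    rcases hsign u hu with h | h
    · simpa only [h, one_smul] using hT.1 u hu
    · simpa only [h, hneg] using (hT.1 u hu).neg
  · intro v hv v' hv' hne
    obtain ⟨u, hu, rfl⟩ := Finset.mem_image.1 hv
    obtain ⟨u', hu', rfl⟩ := Finset.mem_image.1 hv'
    have ho := hT.2 u hu u' hu' (by rintro rfl; exact hne rfl)
    rcases hsign u hu with h | h <;> rcases hsign u' hu' with h' | h' <;>
      simp only [h, h', hneg, one_smul]
    exacts [ho, ho.neg_right, ho.symm.neg_right.symm, ho.symm.neg_right.symm.neg_right]
  · intro v hv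
    obtain ⟨u, hu, rfl⟩ := Finset.mem_image.1 hv
    have hat : IsAtom u := ⟨hT.1 u hu, e u, hface u hu⟩
    rcases hsign u hu with h | h
    · simpa only [h, one_smul] using hat
    · simpa only [h, hneg] using hat.neg
  · rw [Finset.sum_image hinj]
    ext f
    rw [hysum f, sum_apply]
    rfl
  · intro f hf
    rw [hexp f hf]
    refine sum_mem fun u hu => ?_
    have hcase : u f • e u = (u f * y (e u)) • (y (e u) • e u) := by
      rcases hsign u hu with h | h <;> simp [h]
    rw [hcase]
    refine Submodule.smul_mem _ _ (Submodule.subset_span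
      ⟨_, Finset.mem_image_of_mem _ hu, ?_, ?_⟩)
    · rcases hsign u hu with h | h <;> simpa [h] using (he u hu).1
    · rcases hsign u hu with h | h <;> simp [h, (he u hu).2]

/-- The atoms below a sum of orthogonal atoms are its summands. -/
theorem OrthFinset.mem_of_face_subset (hT : OrthFinset T) (hTa : ∀ u ∈ T, IsAtom u)
    (hspan : V2 (∑ u ∈ T, u) ≤ Submodule.span ℝ {f | ∃ u ∈ T, f ∈ face u}) (hu : IsAtom u)
    (h : face u ⊆ face (∑ v ∈ T, v)) : u ∈ T := by
  classical
  obtain ⟨hu, f, hf⟩ := hu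
  have hfu : f ∈ face u := by rw [hf]; rfl
  choose! e he using fun v (hv : v ∈ T) => (hTa v hv).2
  have hev : ∀ v ∈ T, e v ∈ face v := fun v hv => by rw [he v hv]; rfl
  have hexp : ∀ g ∈ V2 (∑ u ∈ T, u), g = ∑ v ∈ T, v g • e v := fun g hg => by
    refine Submodule.span_induction (p := fun g _ => g = ∑ v ∈ T, v g • e v) ?_ (by simp) ?_ ?_
      (hspan hg)
    · rintro g ⟨v, hv, hgv⟩
      rw [Finset.sum_eq_single v]
      · rw [he v hv] at hgv
        rw [hgv, (hev v hv).2, one_smul]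
      · intro w hw hwv
        rw [(hT.2 w hw v hv hwv).apply_face (hT.1 w hw) hgv, zero_smul]
      · exact fun h => absurd hv h
    · intro a b _ _ ha hb
      conv_lhs => rw [ha, hb]
      simp [add_smul, Finset.sum_add_distrib]
    · intro c a _ ha
      conv_lhs => rw [ha]
      simp [mul_smul, Finset.smul_sum]
  have h1 : ∑ v ∈ T, v f = 1 := by rw [← sum_apply]; exact (h hfu).2
  have h2 : ∑ v ∈ T, v f * u (e v) = 1 := by
    have := hfu.2
    rw [hexp f (face_subset_V2 _ (h hfu)), map_sum] at this
    simpa using this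
  have h3 := (hT.sum_abs_le f).trans hfu.1
  have hle : ∀ v ∈ T, v f * u (e v) ≤ |v f| := fun v hv => by
    refine (le_abs_self _).trans ?_
    rw [abs_mul]
    refine mul_le_of_le_one_right (abs_nonneg _) ?_
    have := u.le_of_opNorm_le hu.norm_eq.le (e v)
    rw [one_mul] at this
    exact this.trans (hev v hv).1
  have e1 := (Finset.sum_eq_sum_iff_of_le hle).1
    (le_antisymm (Finset.sum_le_sum hle) (h2 ▸ h3))
  have hle' : ∀ v ∈ T, v f ≤ |v f| := fun v _ => le_abs_self _
  have e2 := (Finset.sum_eq_sum_iff_of_le hle').1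
    (le_antisymm (Finset.sum_le_sum hle') (h1 ▸ h3))
  obtain ⟨v, hv, hv0⟩ : ∃ v ∈ T, v f ≠ 0 :=
    Finset.exists_ne_zero_of_sum_ne_zero (by rw [h1]; exact one_ne_zero)
  have huv : u (e v) = 1 := by
    have := (e1 v hv).trans (e2 v hv).symm
    rwa [mul_eq_left₀ hv0] at this
  have hmem : e v ∈ face u := ⟨(hev v hv).1, huv⟩
  rw [hf] at hmem
  have : face v = face u := by rw [hf, he v hv, hmem]
  rwa [← (hT.1 v hv).ext_face hu this]

theorem FaceOrth.V2_add_le (h : FaceOrth u v) (hu : IsAtom u) (hv : IsAtom v) :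
    V2 (u + v) ≤ V2 u ⊔ V2 v := by
  obtain ⟨T, hT, hTa, hsum, hspan⟩ := exists_atoms (h.add_tripotent hu.1 hv.1)
  have h1 := (h.norm_add_eq hu.1 hv.1).2
  have h2 := (h.symm.norm_add_eq hv.1 hu.1).2
  rw [add_comm v u] at h2
  refine hspan.trans (Submodule.span_le.2 ?_)
  rintro f ⟨t, ht, hft⟩
  by_cases htu : t = u
  · subst htu
    exact Submodule.mem_sup_left (face_subset_V2 _ hft)
  by_cases htv : t = v
  · subst htv
    exact Submodule.mem_sup_right (face_subset_V2 _ hft)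
  rw [hsum] at hspan h1 h2
  have huT := hT.mem_of_face_subset hTa hspan hu h1
  have hvT := hT.mem_of_face_subset hTa hspan hv h2
  have := (hT.face_subset_face_sum ht hft).2
  rw [← hsum, add_apply, (hT.2 u huT t ht (Ne.symm htu)).apply_face hu.1 hft,
    (hT.2 v hvT t ht (Ne.symm htv)).apply_face hv.1 hft] at this
  norm_num at this

theorem FaceOrth.eq_zero_of_sym_eq_neg (h : FaceOrth u v) (hu : IsAtom u) (hv : IsAtom v) {g : Z}
    (hgu : sym u g = -g) (hgv : sym v g = -g) : g = 0 := by
  have hn := (h.norm_add_eq hu.1 hv.1).1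
  have h1 : sym (u + v) g = g := by
    rw [← h.sym_add hu.1 hv.1, hgv, map_neg, hgu, neg_neg]
  obtain ⟨a, ha, b, hb, rfl⟩ := Submodule.mem_sup.1 ((sym_eq_iff hn).1 h1)
  have ha' : a ∈ V2 u ⊔ V0 u :=
    sup_le_sup_left (h.V2_le_V0 hu.1.norm_eq) _ (h.V2_add_le hu hv ha)
  have hb' : b ∈ V0 u := by
    rw [h.V0_add hu.1 hv.1] at hb
    exact hb.1
  have h2 := (sym_eq_iff hu.1.norm_eq).2 (add_mem ha' (Submodule.mem_sup_right hb'))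
  exact eq_zero_of_eq_neg (h2.symm.trans hgu)

end

section

variable {Z : Type*} [NormedAddCommGroup Z] [NormedSpace ℝ Z] [FiniteDimensional ℝ Z]

/-- A maximal family of orthogonal atoms. -/
structure IsFrame {k : ℕ} (a : Fin k → StrongDual ℝ Z) : Prop where
  atom : ∀ i, IsAtom (a i)
  orth : ∀ i j, i ≠ j → FaceOrth (a i) (a j)
  card_le : ∀ T : Finset (StrongDual ℝ Z), OrthFinset T → T.card ≤ k

variable [hS : Fact (IsSFS Z)] [hN : Fact (IsNeutral Z)]
variable {k : ℕ} {a : Fin k → StrongDual ℝ Z} {w : StrongDual ℝ Z}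

theorem IsFrame.norm_eq (ha : IsFrame a) (i : Fin k) : ‖a i‖ = 1 := (ha.atom i).1.norm_eq

theorem IsFrame.injective (ha : IsFrame a) : Function.Injective a := fun i j h => by
  by_contra hij
  exact (ha.orth i j hij).ne (ha.atom i).1 h

open Classical in
theorem IsFrame.orthFinset_image (ha : IsFrame a) (s : Finset (Fin k)) :
    OrthFinset (s.image a) := by
  constructor
  · intro u hu
    obtain ⟨i, -, rfl⟩ := Finset.mem_image.1 hu
    exact (ha.atom i).1
  · intro u hu v hv huv
    obtain ⟨i, -, rfl⟩ := Finset.mem_image.1 hu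
    obtain ⟨j, -, rfl⟩ := Finset.mem_image.1 hv
    exact ha.orth i j fun h => huv (by rw [h])

theorem IsFrame.eq_zero (ha : IsFrame a) {g : Z} (hg : ∀ i, g ∈ V0 (a i)) : g = 0 := by
  classical
  by_contra hg0
  have hn : ‖g‖ ≠ 0 := norm_ne_zero_iff.2 hg0
  have hg1 : ‖‖g‖⁻¹ • g‖ = 1 := by rw [norm_smul, norm_inv, norm_norm, inv_mul_cancel₀ hn]
  have hT := ha.orthFinset_image Finset.univ
  obtain ⟨w, hw, -, hwT⟩ := exists_tripotent_face_subset_V0 (Finset.univ.image a)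
    (fun u hu => (hT.1 u hu).norm_eq) hg1 (fun u hu => by
      obtain ⟨i, -, rfl⟩ := Finset.mem_image.1 hu
      exact (V0 (a i)).smul_mem _ (hg i))
  have ho : ∀ u ∈ Finset.univ.image a, FaceOrth u w := fun u hu =>
    (faceOrth_iff_left (hT.1 u hu).norm_eq).2 (hwT u hu)
  have := ha.card_le _ (hT.insert hw ho)
  rw [Finset.card_insert_of_notMem fun h => (ho w h).ne hw rfl,
    Finset.card_image_of_injective _ ha.injective, Finset.card_univ, Fintype.card_fin] at this
  omega

variable [hJ : Fact (HasJP Z)]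

theorem IsFrame.mem_V0_of_sym_eq_neg (ha : IsFrame a) {i j : Fin k} (hij : i ≠ j) {g : Z}
    (hg : sym (a j) g = -g) : g ∈ V0 (a i) := by
  have ho := ha.orth i j hij
  have hi := ha.norm_eq i
  have hj := ha.norm_eq j
  have hfi : ∀ f ∈ face (a i), sym (a j) f = f := fun f hf =>
    sym_of_mem_V0 hj ((faceOrth_iff_right hj).1 ho hf)
  have hd : g - sym (a i) g = 0 := by
    refine ho.eq_zero_of_sym_eq_neg (ha.atom i) (ha.atom j) ?_ ?_
    · rw [map_sub, sym_sym hi]; abel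
    · rw [map_sub, sym_comm_of_fixed hi hfi, hg, map_neg]; abel
  obtain ⟨p, hp, b, hb, rfl⟩ := Submodule.mem_sup.1 ((sym_eq_iff hi).1 (sub_eq_zero.1 hd).symm)
  have hp' : sym (a j) p = p := sym_of_mem_V0 hj (ho.symm.V2_le_V0 hj hp)
  have hb' : sym (a j) b ∈ V0 (a i) := (mem_V0 hi).2 fun f hf => by
    have := ((mem_V0 hi).1 hb f hf).map (sym (a j))
    rwa [hfi f hf] at this
  rw [map_add, hp', neg_add] at hg
  have h := (peirce_unique hi hp (neg_mem hp) hb' (neg_mem hb) hg).1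
  rw [eq_zero_of_eq_neg h, zero_add]
  exact hb

theorem IsFrame.mem_V0_of_mem_ker (ha : IsFrame a) {i j : Fin k} (hij : i ≠ j) {g : Z}
    (hg : P0 (a j) g = 0) : g ∈ V0 (a i) := by
  have hj := ha.norm_eq j
  rw [peirce_decomp hj g, hg, add_zero]
  refine add_mem ((ha.orth i j hij).V2_le_V0 (ha.norm_eq i) (P2_mem hj g))
    (Submodule.smul_mem _ _ (ha.mem_V0_of_sym_eq_neg hij ?_))
  rw [map_sub, sym_sym hj]
  abel

theorem IsFrame.P0_sub_P0 (ha : IsFrame a) (i : Fin k) (f : Z) : P0 (a i) (f - P0 (a i) f) = 0 := by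
  rw [map_sub, (P2_P0_of_mem_V0 (ha.norm_eq i) (P0_mem (ha.norm_eq i) f)).2, sub_self]

theorem IsFrame.sum_eq (ha : IsFrame a) (f : Z) : ∑ i, (f - P0 (a i) f) = f := by
  refine (sub_eq_zero.1 (ha.eq_zero fun i => ?_)).symm
  have h : f - ∑ j, (f - P0 (a j) f) =
      P0 (a i) f - ∑ j ∈ Finset.univ.erase i, (f - P0 (a j) f) := by
    rw [← Finset.add_sum_erase _ _ (Finset.mem_univ i)]
    abel
  rw [h]
  exact sub_mem (P0_mem (ha.norm_eq i) f) (sum_mem fun j hj =>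
    ha.mem_V0_of_mem_ker (Finset.ne_of_mem_erase hj).symm (ha.P0_sub_P0 j f))

theorem IsFrame.mem_ker_iff (ha : IsFrame a) {i : Fin k} {f : Z} :
    P0 (a i) f = 0 ↔ ∀ j, j ≠ i → f ∈ V0 (a j) := by
  refine ⟨fun h j hj => ha.mem_V0_of_mem_ker hj h, fun h => ?_⟩
  have := ha.sum_eq f
  rw [Finset.sum_eq_single i] at this
  · exact sub_eq_self.1 this
  · intro j _ hj
    rw [(P2_P0_of_mem_V0 (ha.norm_eq j) (h j hj)).2, sub_self]
  · simp

/-- An atom of a frame can be replaced by one which exposes a given unit vector of its summand. -/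
theorem IsFrame.exists_update (ha : IsFrame a) {i : Fin k} {h : Z} (hh : ‖h‖ = 1)
    (hi : P0 (a i) h = 0) :
    ∃ w : StrongDual ℝ Z, face w = {h} ∧ IsFrame (Function.update a i w) := by
  classical
  have hT := ha.orthFinset_image (Finset.univ.erase i)
  obtain ⟨w, hw, hhw, hwT⟩ := exists_tripotent_face_subset_V0 ((Finset.univ.erase i).image a)
    (fun u hu => (hT.1 u hu).norm_eq) hh (fun u hu => by
      obtain ⟨j, hj, rfl⟩ := Finset.mem_image.1 hu
      exact ha.mem_ker_iff.1 hi j (Finset.ne_of_mem_erase hj))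
  have hwa : ∀ j, j ≠ i → FaceOrth (a j) w := fun j hj =>
    (faceOrth_iff_left (ha.norm_eq j)).2
      (hwT _ (Finset.mem_image_of_mem a (Finset.mem_erase.2 ⟨hj, Finset.mem_univ j⟩)))
  obtain ⟨R, hR, hRa, hsum, -⟩ := exists_atoms hw
  have hRw : ∀ u ∈ R, face u ⊆ face w := fun u hu => hsum ▸ hR.face_subset_face_sum hu
  have hRT : ∀ u ∈ R, ∀ v ∈ (Finset.univ.erase i).image a, FaceOrth u v := by
    intro u hu v hv f hf g hg
    obtain ⟨j, hj, rfl⟩ := Finset.mem_image.1 hv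
    exact (hwa j (Finset.ne_of_mem_erase hj) g hg f (hRw u hu hf)).symm
  have hunion : OrthFinset (R ∪ (Finset.univ.erase i).image a) := by
    constructor
    · intro u hu
      rcases Finset.mem_union.1 hu with hu' | hu'
      exacts [hR.1 u hu', hT.1 u hu']
    · intro u hu v hv huv
      rcases Finset.mem_union.1 hu with hu' | hu' <;> rcases Finset.mem_union.1 hv with hv' | hv'
      exacts [hR.2 u hu' v hv' huv, hRT u hu' v hv', (hRT v hv' u hu').symm, hT.2 u hu' v hv' huv]
  have hdisj : Disjoint R ((Finset.univ.erase i).image a) := Finset.disjoint_left.2 fun u hu hu' =>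
    (hRT u hu u hu').ne (hR.1 u hu) rfl
  have hcard := ha.card_le _ hunion
  rw [Finset.card_union_of_disjoint hdisj, Finset.card_image_of_injective _ ha.injective,
    Finset.card_erase_of_mem (Finset.mem_univ i), Finset.card_univ, Fintype.card_fin] at hcard
  have hk := i.pos
  have hR1 : R.card = 1 := by
    have : R.card ≠ 0 := fun h0 => by
      rw [Finset.card_eq_zero] at h0
      have := hhw.2
      simp [hsum, h0] at this
    omega
  obtain ⟨t, rfl⟩ := Finset.card_eq_one.1 hR1
  rw [Finset.sum_singleton] at hsum
  have hwat : IsAtom w := hsum ▸ hRa t (by simp)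
  obtain ⟨-, e, he⟩ := id hwat
  have hhe : h = e := by rwa [he] at hhw
  refine ⟨w, by rw [he, hhe], fun j => ?_, fun j l hjl => ?_, ha.card_le⟩
  · rcases eq_or_ne j i with rfl | hj
    · rwa [Function.update_self]
    · rw [Function.update_of_ne hj]
      exact ha.atom j
  · rcases eq_or_ne j i with rfl | hj
    · rw [Function.update_self, Function.update_of_ne hjl.symm]
      exact (hwa l hjl.symm).symm
    · rw [Function.update_of_ne hj]
      rcases eq_or_ne l i with rfl | hl
      · rw [Function.update_self]
        exact hwa j hj
      · rw [Function.update_of_ne hl]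
        exact ha.orth j l hjl

theorem IsFrame.exists_update_smul (ha : IsFrame a) {i : Fin k} {h : Z} (hi : P0 (a i) h = 0) :
    ∃ (w : StrongDual ℝ Z) (e : Z), face w = {e} ∧ P0 (a i) e = 0 ∧ h = ‖h‖ • e ∧
      IsFrame (Function.update a i w) := by
  rcases eq_or_ne h 0 with rfl | h0
  · obtain ⟨-, e, he⟩ := ha.atom i
    have hmem : e ∈ face (a i) := by rw [he]; rfl
    refine ⟨a i, e, he, (P2_P0_of_mem_V2 (ha.norm_eq i) (face_subset_V2 _ hmem)).2, by simp, ?_⟩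
    rwa [Function.update_eq_self]
  · have hn : ‖h‖ ≠ 0 := norm_ne_zero_iff.2 h0
    have he : P0 (a i) (‖h‖⁻¹ • h) = 0 := by rw [map_smul, hi, smul_zero]
    obtain ⟨w, hw, hfr⟩ := ha.exists_update
      (by rw [norm_smul, norm_inv, norm_norm, inv_mul_cancel₀ hn]) he
    exact ⟨w, _, hw, he, (smul_inv_smul₀ hn h).symm, hfr⟩

theorem IsFrame.norm_sum (ha : IsFrame a) {h : Fin k → Z} (hh : ∀ i, P0 (a i) (h i) = 0) :
    ‖∑ i, h i‖ = ∑ i, ‖h i‖ := by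
  classical
  refine le_antisymm (norm_sum_le _ _) ?_
  choose w e hwe he hhe hfr using fun i => ha.exists_update_smul (hh i)
  have hwt : ∀ i, IsGeometricTripotent (w i) := fun i => by
    simpa using ((hfr i).atom i).1
  have hV0 : ∀ i j, i ≠ j → ∀ g, P0 (a j) g = 0 → g ∈ V0 (w i) := fun i j hij g hg => by
    have := (hfr i).mem_V0_of_mem_ker hij (g := g) (by rwa [Function.update_of_ne hij.symm])
    rwa [Function.update_self] at this
  have hemem : ∀ i, e i ∈ face (w i) := fun i => by rw [hwe]; rfl
  have ho : ∀ i j, i ≠ j → FaceOrth (w i) (w j) := fun i j hij =>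
    (faceOrth_iff_left (hwt i).norm_eq).2 fun g hg => by
      rw [hwe] at hg
      rw [hg]
      exact hV0 i j hij _ (he j)
  have hinj : Function.Injective w := fun i j hij => by
    by_contra hne
    exact (ho i j hne).ne (hwt i) hij
  have hT : OrthFinset (Finset.univ.image w) := by
    constructor
    · intro u hu
      obtain ⟨i, -, rfl⟩ := Finset.mem_image.1 hu
      exact hwt i
    · intro u hu v hv huv
      obtain ⟨i, -, rfl⟩ := Finset.mem_image.1 hu
      obtain ⟨j, -, rfl⟩ := Finset.mem_image.1 hv
      exact ho i j fun h => huv (by rw [h])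
  have hle := hT.sum_abs_le (∑ i, h i)
  rw [Finset.sum_image hinj.injOn] at hle
  refine (Finset.sum_le_sum fun i _ => ?_).trans hle
  rw [map_sum, Finset.sum_eq_single i]
  · have : w i (h i) = ‖h i‖ := by
      conv_lhs => rw [hhe i]
      rw [map_smul, (hemem i).2, smul_eq_mul, mul_one]
    rw [this]
    exact le_abs_self _
  · exact fun j _ hj => (hwt i).apply_V0 (hV0 i j hj.symm _ (hh j))
  · simp

/-- The summands of a frame have reflections in all their vectors. -/
theorem IsFrame.exists_reflection (ha : IsFrame a) {i : Fin k} {h : Z} (hi : P0 (a i) h = 0) :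
    h ≠ 0 → ∃ S : Z ≃ₗᵢ[ℝ] Z, S h = h ∧ ∀ x, P0 (a i) x = 0 → ∃ c : ℝ, x + S x = c • h := by
  intro h0
  obtain ⟨w, e, hwe, -, hhe, hfr⟩ := ha.exists_update_smul hi
  have hn : ‖h‖ ≠ 0 := norm_ne_zero_iff.2 h0
  have hw1 : ‖w‖ = 1 := by simpa using hfr.norm_eq i
  have hV2 : V2 w = Submodule.span ℝ {e} := by rw [V2, hwe]
  refine ⟨sym w, sym_of_mem_V2 hw1 ?_, fun x hx => ?_⟩
  · rw [hV2, hhe]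
    exact Submodule.smul_mem _ _ (Submodule.mem_span_singleton_self e)
  · have hxw : P0 w x = 0 := by
      have := hfr.mem_ker_iff (i := i) (f := x)
      rw [Function.update_self] at this
      refine this.2 fun j hj => ?_
      rw [Function.update_of_ne hj]
      exact ha.mem_ker_iff.1 hx j hj
    have h1 := P2_mem hw1 x
    rw [hV2] at h1
    obtain ⟨c, hc⟩ := Submodule.mem_span_singleton.1 h1
    have h2 := P2_add_P0 hw1 x
    rw [hxw, add_zero, ← hc] at h2
    refine ⟨2 * c * ‖h‖⁻¹, ?_⟩
    conv_rhs => rw [hhe]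
    rw [smul_smul, mul_assoc, norm_smul, norm_norm,
      norm_of_mem_face (f := e) hw1.le (by rw [hwe]; rfl)]
    have h3 : x + sym w x = (2 : ℝ) • (c • e) := by rw [h2]; module
    rw [h3, smul_smul, mul_one, inv_mul_cancel₀ hn, mul_one]

theorem exists_frame (Z : Type*) [NormedAddCommGroup Z] [NormedSpace ℝ Z] [FiniteDimensional ℝ Z]
    [Fact (IsSFS Z)] [Fact (IsNeutral Z)] [Fact (HasJP Z)] :
    ∃ (k : ℕ) (a : Fin k → StrongDual ℝ Z), IsFrame a := by
  obtain ⟨T, hT, hmax⟩ := exists_maximal_card (P := OrthFinset (Z := Z))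
    (N := Module.finrank ℝ Z) ⟨∅, by simp, by simp⟩ fun T hT => hT.card_le
  have hex : ∀ u : T, ∃ t, IsAtom t ∧ face t ⊆ face (u : StrongDual ℝ Z) := fun u => by
    obtain ⟨R, hR, hRa, hsum, -⟩ := exists_atoms (hT.1 u u.2)
    have hne : R.Nonempty := by
      rw [Finset.nonempty_iff_ne_empty]
      rintro rfl
      have := (hT.1 u u.2).norm_eq
      simp [hsum] at this
    obtain ⟨t, ht⟩ := hne
    refine ⟨t, hRa t ht, ?_⟩
    rw [hsum]
    exact hR.face_subset_face_sum ht
  choose b hb hbu using hex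
  refine ⟨T.card, fun i => b (T.equivFin.symm i), fun i => hb _, fun i j hij => ?_, hmax⟩
  have hne : T.equivFin.symm i ≠ T.equivFin.symm j := fun h => hij (T.equivFin.symm.injective h)
  exact fun f hf g hg => hT.2 _ (T.equivFin.symm i).2 _ (T.equivFin.symm j).2
    (fun h => hne (Subtype.ext h)) f (hbu _ hf) g (hbu _ hg)

theorem IsFrame.hasRank (ha : IsFrame a) : HasRank Z k := by
  classical
  constructor
  · rintro T ⟨hT, hTo⟩
    by_contra! hcon
    obtain ⟨t, htT, htc⟩ := Set.exists_subset_encard_eq (Order.add_one_le_of_lt hcon)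
    have hfin : t.Finite := Set.finite_of_encard_eq_coe (k := k + 1) (by simpa using htc)
    lift t to Finset (StrongDual ℝ Z) using hfin
    have ho : OrthFinset t := ⟨fun u hu => hT u (htT hu), fun u hu v hv huv =>
      (tripotentOrth_iff (hT u (htT hu)) (hT v (htT hv))).1 (hTo (htT hu) (htT hv) huv)⟩
    have h1 := ha.card_le t ho
    rw [Set.encard_coe_eq_coe_finsetCard] at htc
    have h2 : t.card = k + 1 := by exact_mod_cast htc
    omega
  · refine ⟨Set.range a, ⟨?_, ?_⟩, ?_⟩
    · rintro _ ⟨i, rfl⟩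
      exact (ha.atom i).1
    · rintro _ ⟨i, rfl⟩ _ ⟨j, rfl⟩ hij
      exact (tripotentOrth_iff (ha.atom i).1 (ha.atom j).1).2
        (ha.orth i j fun h => hij (by rw [h]))
    · rw [← Set.image_univ, ha.injective.injOn.encard_image]
      simp

end

/-- A subspace with reflections in all its vectors satisfies the parallelogram law. -/
theorem parallelogram_of_reflections {Z : Type*} [NormedAddCommGroup Z] [NormedSpace ℝ Z]
    [FiniteDimensional ℝ Z] (H : Submodule ℝ Z)
    (hH : ∀ h ∈ H, h ≠ 0 → ∃ S : Z ≃ₗᵢ[ℝ] Z, S h = h ∧ ∀ x ∈ H, ∃ c : ℝ, x + S x = c • h)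
    {x y : Z} (hx : x ∈ H) (hy : y ∈ H) :
    ‖x + y‖ * ‖x + y‖ + ‖x - y‖ * ‖x - y‖ = 2 * (‖x‖ * ‖x‖ + ‖y‖ * ‖y‖) := by
  obtain ⟨B, hBsymm, hBpos, hBinv⟩ := exists_invariant_form Z
  have hunit : ∀ f ∈ H, ∀ g ∈ H, B f f = 1 → B g g = 1 → ‖f‖ = ‖g‖ := by
    intro f hf g hg hf1 hg1
    by_cases hm : f + g = 0
    · rw [eq_neg_of_add_eq_zero_left hm, norm_neg]
    obtain ⟨S, hS, hSx⟩ := hH _ (add_mem hf hg) hm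
    obtain ⟨c, hc⟩ := hSx _ (sub_mem hf hg)
    have h1 : B (f - g) (f + g) = 0 := by
      simp only [map_sub, map_add, LinearMap.sub_apply, hf1, hg1, hBsymm g f]
      ring
    have h2 : B (S (f - g)) (f + g) = 0 := by
      conv_lhs => rw [← hS]
      rw [hBinv, h1]
    have h3 : c * B (f + g) (f + g) = 0 := by
      rw [← smul_eq_mul, ← LinearMap.smul_apply, ← map_smul, ← hc, map_add B, LinearMap.add_apply,
        h1, h2, add_zero]
    have hc0 : c = 0 := (mul_eq_zero.1 h3).resolve_right (hBpos _ hm).ne'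
    rw [hc0, zero_smul, map_sub] at hc
    rw [map_add] at hS
    have h4 : S f = g := by
      have : (2 : ℝ) • S f = (2 : ℝ) • g := by
        have e1 : S f - S g = g - f := by
          rw [← sub_eq_zero, ← hc]
          abel
        have e2 : (2 : ℝ) • S f = (S f + S g) + (S f - S g) := by module
        rw [e2, hS, e1]
        module
      exact smul_right_injective Z two_ne_zero this
    rw [← h4, S.norm_map]
  have hconst : ∃ c : ℝ, ∀ f ∈ H, ‖f‖ * ‖f‖ = c * B f f := by
    by_cases htriv : ∃ h ∈ H, h ≠ 0
    · obtain ⟨h, hh, h0⟩ := htriv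
      have hnormal : ∀ f ∈ H, f ≠ 0 → ∃ e ∈ H, B e e = 1 ∧ f = √(B f f) • e := fun f hf hf0 => by
        have hs : √(B f f) ≠ 0 := (Real.sqrt_pos.2 (hBpos f hf0)).ne'
        refine ⟨(√(B f f))⁻¹ • f, H.smul_mem _ hf, ?_, (smul_inv_smul₀ hs f).symm⟩
        simp only [map_smul, LinearMap.smul_apply, smul_eq_mul]
        nth_rewrite 3 [← Real.mul_self_sqrt (hBpos f hf0).le]
        field_simp
      obtain ⟨e, he, he1, -⟩ := hnormal h hh h0
      refine ⟨‖e‖ * ‖e‖, fun f hf => ?_⟩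
      rcases eq_or_ne f 0 with rfl | hf0
      · simp
      obtain ⟨g, hg, hg1, hfg⟩ := hnormal f hf hf0
      have hn : ‖f‖ = √(B f f) * ‖e‖ := by
        conv_lhs => rw [hfg]
        rw [norm_smul, Real.norm_of_nonneg (Real.sqrt_nonneg _), hunit g hg e he hg1 he1]
      rw [hn]
      nth_rewrite 3 [← Real.mul_self_sqrt (hBpos f hf0).le]
      ring
    · push Not at htriv
      exact ⟨0, fun f hf => by simp [htriv f hf]⟩
  obtain ⟨c, hc⟩ := hconst
  rw [hc _ (add_mem hx hy), hc _ (sub_mem hx hy), hc _ hx, hc _ hy]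
  simp only [map_sub, map_add, LinearMap.sub_apply, LinearMap.add_apply, hBsymm y x]
  ring

end FaciallySymmetric

theorem theorem1 {Z : Type u} [NormedAddCommGroup Z] [NormedSpace ℝ Z]
    [FiniteDimensional ℝ Z] (hSFS : FaciallySymmetric.IsSFS Z)
    (hN : FaciallySymmetric.IsNeutral Z) (hJP : FaciallySymmetric.HasJP Z) :
    ∃ k : ℕ, FaciallySymmetric.HasRank Z k ∧
      ∃ (H : Fin k → Type u) (_ : ∀ i, NormedAddCommGroup (H i))
        (_ : ∀ i, InnerProductSpace ℝ (H i)),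
        (∀ i, CompleteSpace (H i)) ∧ (∀ i, Nontrivial (H i)) ∧
          Nonempty (Z ≃ₗᵢ[ℝ] PiLp 1 H) := by
  have : Fact (FaciallySymmetric.IsSFS Z) := ⟨hSFS⟩
  have : Fact (FaciallySymmetric.IsNeutral Z) := ⟨hN⟩
  have : Fact (FaciallySymmetric.HasJP Z) := ⟨hJP⟩
  obtain ⟨k, a, ha⟩ := FaciallySymmetric.exists_frame Z
  let K : Fin k → Submodule ℝ Z := fun i => LinearMap.ker (FaciallySymmetric.P0 (a i))
  have hpar : ∀ i, InnerProductSpaceable (K i) := fun i => ⟨fun x y =>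
    FaciallySymmetric.parallelogram_of_reflections (K i)
      (fun h hh h0 => ha.exists_reflection hh h0) x.2 y.2⟩
  let L : PiLp 1 (fun i => K i) →ₗ[ℝ] Z :=
    { toFun := fun h => ∑ i, (h i : Z)
      map_add' := fun h h' => by simp [Finset.sum_add_distrib]
      map_smul' := fun c h => by simp [Finset.smul_sum] }
  let Li : PiLp 1 (fun i => K i) →ₗᵢ[ℝ] Z :=
    { L with
      norm_map' := fun h => by
        change ‖∑ i, (h i : Z)‖ = ‖h‖
        rw [ha.norm_sum fun i => (h i).2, PiLp.norm_eq_of_L1]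
        rfl }
  have hsurj : Function.Surjective Li := fun f =>
    ⟨WithLp.toLp 1 fun i => ⟨f - FaciallySymmetric.P0 (a i) f, ha.P0_sub_P0 i f⟩, ha.sum_eq f⟩
  refine ⟨k, ha.hasRank, fun i => K i, fun i => inferInstance,
    fun i => InnerProductSpace.ofNorm ℝ fun x y => (hpar i).parallelogram_identity x y,
    fun i => inferInstance, fun i => ?_, ⟨(LinearIsometryEquiv.ofSurjective Li hsurj).symm⟩⟩
  obtain ⟨-, e, he⟩ := ha.atom i
  have hmem : e ∈ FaciallySymmetric.face (a i) := by rw [he]; rfl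
  refine ⟨⟨e, (FaciallySymmetric.P2_P0_of_mem_V2 (ha.norm_eq i)
    (FaciallySymmetric.face_subset_V2 _ hmem)).2⟩, 0, fun h => ?_⟩
  have h0 : e = 0 := congrArg Subtype.val h
  have := FaciallySymmetric.norm_of_mem_face (ha.norm_eq i).le hmem
  rw [h0, norm_zero] at this
  exact zero_ne_one this
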